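/- Let $n\ge 2$ be an integer, let $q$ be a prime power, and let $M_n(q)$ be the ring of all $n\times n$ matrices over the field $\mathbb F_q$ with $q$ elements. Let $b$ be the smallest prime divisor of $n$, and let $N(b)$ be the number of subspaces of $\mathbb F_q^n$ whose dimension is not divisible by $b$ and is at most $n/2$. Here a subring of a ring is a subset that contains $0$ and is closed under subtraction and multiplication; it need not contain the multiplicative identity. Then $M_n(q)$ is the union of finitely many proper subrings, and the minimal number $\sigma(M_n(q))$ of proper subrings of $M_n(q)$ whose union is $M_n(q)$ is $$\sigma(M_n(q))=\frac1b\prod_{\substack{1\le i\le n-1\\ b\nmid i}}\left(q^n-q^i\right)+N(b).$$ -/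

import Mathlib

/-- A finite set `C` of subrings of `R` is a proper cover if all its members are proper and their
union is `R`. Subrings are not required to contain a multiplicative identity. -/
def IsProperSubringCover {R : Type*} [NonUnitalRing R] (C : Finset (NonUnitalSubring R)) : Prop :=
  (∀ S ∈ C, S ≠ ⊤) ∧ ∀ x : R, ∃ S ∈ C, x ∈ S

/-- `R` is the union of finitely many proper subrings. -/
def IsProperlyCoverable (R : Type*) [NonUnitalRing R] : Prop :=
  ∃ C : Finset (NonUnitalSubring R), IsProperSubringCover C

/-- `σ(R)`: the minimal number of proper subrings of `R` whose union is `R`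
(meaningful when `R` is the union of finitely many proper subrings). -/
noncomputable def coveringNumber (R : Type*) [NonUnitalRing R] : ℕ :=
  sInf {k : ℕ | ∃ C : Finset (NonUnitalSubring R), IsProperSubringCover C ∧ C.card = k}

/-- The number of subspaces of `F ^ n` whose dimension is not divisible by `b` and is at most
`n / 2`. -/
noncomputable def numSubspaces (F : Type*) [Field F] (n b : ℕ) : ℕ :=
  Set.ncard {U : Submodule F (Fin n → F) |
    ¬ b ∣ Module.finrank F U ∧ (Module.finrank F U : ℚ) ≤ (n : ℚ) / 2}

open Module

/-! Write `V` for F_q^n and say that a field `K` embeds if there is an algebra map K → End V.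

Upper bound. Let x be an endomorphism. If every x-invariant subspace of dimension at most n/2 has
dimension divisible by b, then every residue field of F[x] has degree divisible by b. Hence F_{q^b}
maps to each residue field, and by étaleness to F[x] itself, so x centralizes an embedded F_{q^b}
(`exists_invariant_or_commute`). Thus the stabilizers of the N(b) subspaces and the centralizers of
the embedded F_{q^b} cover. The embeddings form one GL(V)-orbit of size |GL_n(q)| / |GL_{n/b}(q^b)|,
which is the product in the formula. Embeddings that differ by one of the b Galois automorphisms
have the same centralizer.

Lower bound. This is a weighted count, dual to the covering problem. Choose test elements x_0 and
x_k, for k ≤ n/2 with b ∤ k, lying in few maximal subrings (`IsTestElement`). Give x_0 the weight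
(number of embeddings of F_{q^b}) / b, and x_k the number of k-dimensional subspaces. The conjugates
of each x_k must all be covered, so it suffices that for a proper subring A the weighted sum of the
proportions of g with g x_k g⁻¹ ∈ A is at most 1 (`weight_le_of_ne_top`). A proper subalgebra either
fixes a subspace or commutes with a field of prime degree p ∣ n. For a subspace, and for p = b, at
most one kind of test element contributes, with total at most 1. For p > b there are so many
embeddings that crude estimates give 7/16 + 9/16. -/

/-! ### Proper subalgebras of End V -/

/-- Without invariant subspaces `V` is simple over `S`, and Schur and Wedderburn make the commutant
a finite field. By density it is larger than `F` when `S` is proper, so it contains an extension of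
`F` of prime degree. -/
theorem Subalgebra.exists_invariant_or_commuting {F V : Type*} [Field F] [Finite F] [AddCommGroup V]
    [Module F V] [FiniteDimensional F V] [Nontrivial V] (c : ℕ) [Fact c.Prime] [CharP F c]
    (S : Subalgebra F (End F V)) (hS : S ≠ ⊤) :
    (∃ U : Submodule F V, U ≠ ⊥ ∧ U ≠ ⊤ ∧ ∀ a ∈ S, ∀ u ∈ U, a u ∈ U) ∨
    ∃ (p : ℕ) (_ : NeZero p), p.Prime ∧ p ∣ finrank F V ∧
      ∃ φ : FiniteField.Extension F c p →ₐ[F] End F V, ∀ a ∈ S, ∀ k, Commute (φ k) a := by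
  classical
  by_cases hsimple : IsSimpleModule S V
  swap
  · left
    by_contra! hcon
    apply hsimple
    rw [isSimpleModule_iff]
    refine { eq_bot_or_eq_top := fun W => ?_ }
    by_contra! h
    obtain ⟨a, ha, u, hu, hau⟩ := hcon (W.restrictScalars F) (by simpa using h.1)
      (by simpa using h.2)
    exact hau (W.smul_mem ⟨a, ha⟩ hu)
  right
  have : Finite V := Module.finite_of_finite F
  have : Finite (End S V) := Finite.of_injective (fun f : End S V => (f : V → V))
    DFunLike.coe_injective
  let _ : Field (End S V) := littleWedderburn (End S V)
  let ι : End S V →ₐ[F] End F V :=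
    { toFun := fun f => f.restrictScalars F
      map_one' := rfl
      map_mul' := fun _ _ => rfl
      map_zero' := rfl
      map_add' := fun _ _ => rfl
      commutes' := fun _ => rfl }
  have hfin : Module.Finite (End S V) V := inferInstance
  have hsurj := Module.Finite.toModuleEnd_moduleEnd_surjective (R := S) (M := V)
  have : IsScalarTower F (End S V) V := inferInstance
  have hmul : finrank F (End S V) * finrank (End S V) V = finrank F V := finrank_mul_finrank _ _ _
  -- If the commutant is only `F`, every `F`-linear map is linear over the commutant, so density
  -- puts it in `S`.
  by_cases h1 : finrank F (End S V) = 1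
  · exfalso
    apply hS
    rw [eq_top_iff]
    intro f _
    have hs : ∀ d : End S V, ∃ r : F, r • (1 : End S V) = d :=
      (finrank_eq_one_iff_of_nonzero' _ one_ne_zero).1 h1
    let f' : End (End S V) V :=
      { f with
        map_smul' := fun d v => by
          obtain ⟨r, rfl⟩ := hs d
          exact f.map_smul r v }
    obtain ⟨a, ha⟩ := hsurj f'
    have : (a : End F V) = f := by
      ext v
      exact congrArg (fun g : End (End S V) V => g v) ha
    rw [← this]
    exact a.2
  · obtain ⟨p, hp, hpd⟩ := Nat.exists_prime_and_dvd h1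
    have : NeZero p := ⟨hp.ne_zero⟩
    refine ⟨p, this, hp, hpd.trans ⟨_, hmul.symm⟩, ?_⟩
    obtain ⟨ψ⟩ := FiniteField.nonempty_algHom_of_finrank_dvd (F := F)
      (K := FiniteField.Extension F c p) (L := End S V) (by rwa [FiniteField.finrank_extension])
    refine ⟨ι.comp ψ, fun a ha k => ?_⟩
    ext v
    exact (ψ k).map_smul (⟨a, ha⟩ : S) v

/-! ### Orbit counts for field embeddings and for subspaces -/

/-- By `hmul`, left multiplication permutes the fibres of `f`, so all fibres have the same size.
This is orbit-stabilizer counting without an explicit action on `X`. -/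
theorem Nat.card_fiber_mul_card {G X : Type*} [Group G] [Finite G] [Finite X] (f : G → X)
    (hf : Function.Surjective f) (hmul : ∀ a g h, f g = f h → f (a * g) = f (a * h)) (y : X) :
    Nat.card {g // f g = y} * Nat.card X = Nat.card G := by
  have hcard : ∀ z, Nat.card {g // f g = z} = Nat.card {g // f g = y} := by
    intro z
    obtain ⟨g, rfl⟩ := hf z
    obtain ⟨h, rfl⟩ := hf y
    refine Nat.card_congr ((Equiv.mulLeft (h * g⁻¹)).subtypeEquiv fun a => ?_)
    constructor
    · intro ha
      have := hmul (h * g⁻¹) _ _ ha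
      simpa [mul_assoc] using this
    · intro ha
      have := hmul (g * h⁻¹) _ _ ha
      simpa [mul_assoc] using this
  let _ := Fintype.ofFinite X
  rw [← Nat.card_congr (Equiv.sigmaFiberEquiv f), Nat.card_sigma]
  simp only [hcard]
  rw [Finset.sum_const, Finset.card_univ, smul_eq_mul, mul_comm, Nat.card_eq_fintype_card (α := X)]

theorem Nat.card_linearEquiv (K V : Type*) [Field K] [Finite K] [AddCommGroup V] [Module K V]
    [FiniteDimensional K V] :
    Nat.card (V ≃ₗ[K] V) =
      ∏ i ∈ Finset.range (finrank K V), (Nat.card K ^ finrank K V - Nat.card K ^ i) := by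
  have := Fintype.ofFinite K
  rw [Nat.card_congr (LinearMap.GeneralLinearGroup.generalLinearEquiv K V).symm.toEquiv,
    Nat.card_congr (Units.mapEquiv
      (LinearMap.toMatrixAlgEquiv (finBasis K V)).toMulEquiv).toEquiv]
  rw [Finset.prod_range, Nat.card_eq_fintype_card (α := K)]
  exact Matrix.card_GL_field _ 

/-- `V` regarded as a `K`-module through `φ`. -/
@[nolint unusedArguments]
def AlgHomModule {F K V : Type*} [Field F] [Field K] [Algebra F K] [AddCommGroup V] [Module F V]
    (_φ : K →ₐ[F] End F V) : Type _ := V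

namespace AlgHomModule

variable {F K V : Type*} [Field F] [Field K] [Algebra F K] [AddCommGroup V] [Module F V]
  (φ : K →ₐ[F] End F V)

instance : AddCommGroup (AlgHomModule φ) := inferInstanceAs (AddCommGroup V)
instance : Module F (AlgHomModule φ) := inferInstanceAs (Module F V)
instance : Module K (AlgHomModule φ) := Module.compHom V φ.toRingHom
instance [FiniteDimensional F V] : FiniteDimensional F (AlgHomModule φ) :=
  inferInstanceAs (FiniteDimensional F V)

instance : IsScalarTower F K (AlgHomModule φ) where
  smul_assoc r k v := by
    change φ (r • k) v = r • φ k v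
    rw [map_smul]
    rfl

instance [FiniteDimensional F V] : FiniteDimensional K (AlgHomModule φ) :=
  Module.Finite.of_restrictScalars_finite F K _

theorem finrank_mul_finrank_eq : finrank F K * finrank K (AlgHomModule φ) = finrank F V :=
  finrank_mul_finrank F K (AlgHomModule φ)

end AlgHomModule

section

variable {F K V : Type*} [Field F] [Field K] [Algebra F K] [AddCommGroup V] [Module F V]

/-- A case of Skolem–Noether: both embeddings make `V` a `K`-space of the same dimension, and a
`K`-linear isomorphism between the two structures conjugates one into the other. -/
theorem AlgHomModule.exists_conj_eq [FiniteDimensional F V] [FiniteDimensional F K]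
    (φ ψ : K →ₐ[F] End F V) :
    ∃ g : V ≃ₗ[F] V, (g.conjAlgEquiv F : End F V →ₐ[F] End F V).comp φ = ψ := by
  have h : finrank K (AlgHomModule φ) = finrank K (AlgHomModule ψ) := by
    have h1 := AlgHomModule.finrank_mul_finrank_eq φ
    have h2 := AlgHomModule.finrank_mul_finrank_eq ψ
    exact Nat.eq_of_mul_eq_mul_left finrank_pos (h1.trans h2.symm)
  let e : AlgHomModule φ ≃ₗ[K] AlgHomModule ψ := LinearEquiv.ofFinrankEq _ _ h
  let g : V ≃ₗ[F] V := e.restrictScalars F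
  refine ⟨g, ?_⟩
  ext k v
  exact (e.map_smul k (e.symm v)).trans (congrArg (k • ·) (e.apply_symm_apply v))

/-- The linear automorphisms commuting with the image of `φ` are the `K`-linear ones. -/
def AlgHomModule.conjStabilizerEquiv (φ : K →ₐ[F] End F V) :
    {g : V ≃ₗ[F] V // (g.conjAlgEquiv F : End F V →ₐ[F] End F V).comp φ = φ} ≃
      (AlgHomModule φ ≃ₗ[K] AlgHomModule φ) where
  toFun g :=
    { g.1 with
      map_smul' := fun k v => by
        have h := DFunLike.congr_fun (DFunLike.congr_fun g.2 k) (g.1 (v : V))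
        exact (congrArg (fun w : V => g.1 (φ k w)) (g.1.symm_apply_apply (v : V))).symm.trans h }
  invFun e := ⟨e.restrictScalars F, by
    ext k v
    exact (e.map_smul k (e.symm v)).trans (congrArg (k • ·) (e.apply_symm_apply v))⟩
  left_inv _ := rfl
  right_inv _ := rfl

theorem AlgHomModule.finite_end [Finite F] [FiniteDimensional F V] [FiniteDimensional F K] :
    Finite (K →ₐ[F] End F V) := by
  have : Finite K := Module.finite_of_finite F
  have : Finite V := Module.finite_of_finite F
  have : Finite (End F V) := Finite.of_injective (fun f => (f : V → V)) DFunLike.coe_injective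
  exact Finite.of_injective (fun f => (f : K → End F V)) DFunLike.coe_injective

theorem LinearEquiv.finite_aut [Finite F] [FiniteDimensional F V] : Finite (V ≃ₗ[F] V) := by
  have : Finite V := Module.finite_of_finite F
  exact Finite.of_injective (fun f => (f : V → V)) DFunLike.coe_injective

theorem AlgHomModule.card_conj_fiber_mul_card [Finite F] [FiniteDimensional F V]
    [FiniteDimensional F K]
    (φ ψ : K →ₐ[F] End F V) :
    Nat.card {g : V ≃ₗ[F] V // (g.conjAlgEquiv F : End F V →ₐ[F] End F V).comp φ = ψ} *
      Nat.card (K →ₐ[F] End F V) = Nat.card (V ≃ₗ[F] V) := by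
  have := AlgHomModule.finite_end (F := F) (V := V) (K := K)
  have := LinearEquiv.finite_aut (F := F) (V := V)
  refine Nat.card_fiber_mul_card
    (fun g : V ≃ₗ[F] V => (g.conjAlgEquiv F : End F V →ₐ[F] End F V).comp φ)
    (fun ψ => AlgHomModule.exists_conj_eq φ ψ) (fun a g h hgh => ?_) ψ
  ext k v
  have := DFunLike.congr_fun (DFunLike.congr_fun hgh k) (a.symm v)
  exact congrArg a this

theorem AlgHomModule.nonempty_end [FiniteDimensional F V] [FiniteDimensional F K]
    (h : finrank F K ∣ finrank F V) : Nonempty (K →ₐ[F] End F V) := by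
  obtain ⟨m, hm⟩ := h
  have : finrank F (Fin m → K) = finrank F V := by
    rw [hm, finrank_pi_fintype]; simp [mul_comm]
  let e : (Fin m → K) ≃ₗ[F] V := LinearEquiv.ofFinrankEq _ _ this
  exact ⟨(e.conjAlgEquiv F : End F (Fin m → K) →ₐ[F] End F V).comp
    (Algebra.lsmul F F (Fin m → K))⟩

theorem AlgHomModule.card_end_mul [Finite F] [FiniteDimensional F V] [FiniteDimensional F K]
    (h : finrank F K ∣ finrank F V) :
    Nat.card (K →ₐ[F] End F V) * ∏ i ∈ Finset.range (finrank F V / finrank F K),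
      (Nat.card F ^ finrank F V - Nat.card F ^ (finrank F K * i)) =
    ∏ i ∈ Finset.range (finrank F V), (Nat.card F ^ finrank F V - Nat.card F ^ i) := by
  have : Finite K := Module.finite_of_finite F
  obtain ⟨φ⟩ := AlgHomModule.nonempty_end (V := V) h
  have h1 := AlgHomModule.card_conj_fiber_mul_card φ φ
  rw [Nat.card_congr (AlgHomModule.conjStabilizerEquiv φ), Nat.card_linearEquiv,
    Nat.card_linearEquiv,
    Module.natCard_eq_pow_finrank (K := F) (V := K)] at h1
  rw [← h1, mul_comm]
  have h2 := AlgHomModule.finrank_mul_finrank_eq φ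
  have h3 : finrank F V / finrank F K = finrank K (AlgHomModule φ) := by
    rw [← h2, Nat.mul_div_cancel_left _ finrank_pos]
  simp_rw [h3, ← pow_mul, h2]

theorem Submodule.exists_map_eq_of_finrank_eq [FiniteDimensional F V] {U W : Submodule F V}
    (h : finrank F U = finrank F W) : ∃ g : V ≃ₗ[F] V, U.map (g : V →ₗ[F] V) = W := by
  obtain ⟨U', hU⟩ := U.exists_isCompl
  obtain ⟨W', hW⟩ := W.exists_isCompl
  have h' : finrank F U' = finrank F W' := by
    have h1 := Submodule.finrank_add_eq_of_isCompl hU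
    have h2 := Submodule.finrank_add_eq_of_isCompl hW
    omega
  let e := LinearEquiv.ofFinrankEq U W h
  let e' := LinearEquiv.ofFinrankEq U' W' h'
  let g : V ≃ₗ[F] V := (U.prodEquivOfIsCompl U' hU).symm ≪≫ₗ (e.prodCongr e') ≪≫ₗ
    (W.prodEquivOfIsCompl W' hW)
  refine ⟨g, ?_⟩
  have hle : U.map (g : V →ₗ[F] V) ≤ W := by
    rintro _ ⟨u, hu, rfl⟩
    have : (U.prodEquivOfIsCompl U' hU).symm u = (⟨u, hu⟩, 0) :=
      Submodule.prodEquivOfIsCompl_symm_apply_left U U' hU ⟨u, hu⟩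
    simp [g, this]
  exact Submodule.eq_of_le_of_finrank_eq hle (by rw [LinearEquiv.finrank_map_eq, h])

theorem Submodule.finite_of_finite_field [Finite F] [FiniteDimensional F V] :
    Finite (Submodule F V) := by
  have : Finite V := Module.finite_of_finite F
  exact Finite.of_injective (fun U => (U : Set V)) SetLike.coe_injective

theorem Submodule.card_map_fiber_mul_card [Finite F] [FiniteDimensional F V] (U W : Submodule F V)
    (h : finrank F U = finrank F W) :
    Nat.card {g : V ≃ₗ[F] V // U.map (g : V →ₗ[F] V) = W} *
      Nat.card {X : Submodule F V // finrank F X = finrank F W} = Nat.card (V ≃ₗ[F] V) := by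
  have := Submodule.finite_of_finite_field (F := F) (V := V)
  have := LinearEquiv.finite_aut (F := F) (V := V)
  have key := Nat.card_fiber_mul_card
    (fun g : V ≃ₗ[F] V => (⟨U.map (g : V →ₗ[F] V), by rw [LinearEquiv.finrank_map_eq, h]⟩ :
      {X : Submodule F V // finrank F X = finrank F W}))
    (fun X => by
      obtain ⟨g, hg⟩ := Submodule.exists_map_eq_of_finrank_eq (h.trans X.2.symm)
      exact ⟨g, Subtype.ext hg⟩)
    (fun a g g' hgg => by
      have := congrArg (fun X => Submodule.map (a : V →ₗ[F] V) X.1) hgg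
      simp only [← Submodule.map_comp] at this
      exact Subtype.ext this) ⟨W, rfl⟩
  rw [← key]
  congr 2
  simp [Subtype.ext_iff]

theorem Submodule.card_finrank_eq_compl [FiniteDimensional F V] {k l : ℕ}
    (h : k + l = finrank F V) :
    Nat.card {X : Submodule F V // finrank F X = k} =
      Nat.card {X : Submodule F V // finrank F X = l} := by
  -- Annihilators exchange dimension and codimension; an arbitrary isomorphism brings them back from
  -- the dual to `V`.
  let e : V ≃ₗ[F] Dual F V := LinearEquiv.ofFinrankEq _ _ Subspace.dual_finrank_eq.symm
  refine Nat.card_congr (((Subspace.orderIsoFiniteDimensional (K := F) (V := V)).toEquiv.trans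
    (OrderDual.ofDual.trans (Submodule.orderIsoMapComap e).symm.toEquiv)).subtypeEquiv
      fun X => ?_)
  have h1 := Subspace.finrank_add_finrank_dualAnnihilator_eq X
  have h2 : finrank F (Submodule.comap (e : V →ₗ[F] Dual F V) X.dualAnnihilator) =
      finrank F X.dualAnnihilator := by
    have := Submodule.map_equiv_eq_comap_symm e.symm X.dualAnnihilator
    rw [LinearEquiv.symm_symm] at this
    rw [← LinearEquiv.finrank_map_eq e.symm, this]
  change _ ↔ finrank F (Submodule.comap (e : V →ₗ[F] Dual F V) X.dualAnnihilator) = l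
  omega

end

/-! ### Test elements -/

/-- An endomorphism `x` which lies in few maximal subrings: its proper nonzero invariant subspaces
are at most one of dimension `k` and at most one of complementary dimension, every
subring containing `x` contains the scalars, and `x` commutes with few fields. -/
structure IsTestElement {F V : Type*} [Field F] [AddCommGroup V] [Module F V] (x : End F V)
    (k : ℕ) : Prop where
  algebraMap_mem : ∀ S : NonUnitalSubring (End F V), x ∈ S → ∀ r : F, algebraMap F (End F V) r ∈ S
  finrank_eq : ∀ U : Submodule F V, (∀ u ∈ U, x u ∈ U) → U ≠ ⊥ → U ≠ ⊤ →
    finrank F U = k ∨ finrank F U + k = finrank F V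
  eq_of_finrank_eq : ∀ U W : Submodule F V, (∀ u ∈ U, x u ∈ U) → (∀ w ∈ W, x w ∈ W) →
    finrank F U = finrank F W → U = W
  card_commute_le : ∀ (K : Type) [Field K] [Algebra F K] [FiniteDimensional F K],
    Nat.card {φ : K →ₐ[F] End F V // ∀ a, Commute (φ a) x} ≤
      finrank F K ^ (if k = 0 then 1 else 2)
  dvd_of_commute : ∀ (K : Type) [Field K] [Algebra F K] [FiniteDimensional F K]
    (φ : K →ₐ[F] End F V), (∀ a, Commute (φ a) x) → finrank F K ∣ k

section

variable {F V : Type*} [Field F] [Finite F] [AddCommGroup V] [Module F V] [FiniteDimensional F V]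

/-- The test element is multiplication by a `θ` that generates `B` even as a non-unital ring. Its
invariant subspaces are then the ideals of `B`, and its commutant is `B` itself because the regular
module is cyclic. Each requirement thus becomes one on `B`. -/
theorem isTestElement_of_algebra {B : Type*} [CommRing B] [Algebra F B] [FiniteDimensional F B]
    (e : B ≃ₗ[F] V) (θ : B)
    (hθ : ∀ S : NonUnitalSubring B, θ ∈ S → S = ⊤) (k : ℕ)
    (h1 : ∀ I : Ideal B, I ≠ ⊥ → I ≠ ⊤ →
      finrank F (I.restrictScalars F) = k ∨ finrank F (I.restrictScalars F) + k = finrank F B)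
    (h2 : ∀ I J : Ideal B, I ≠ ⊥ → I ≠ ⊤ → J ≠ ⊥ → J ≠ ⊤ →
      finrank F (I.restrictScalars F) = finrank F (J.restrictScalars F) → I = J)
    (h3 : ∀ (K : Type) [Field K] [Algebra F K] [FiniteDimensional F K],
      Nat.card (K →ₐ[F] B) ≤ finrank F K ^ (if k = 0 then 1 else 2))
    (h4 : ∀ (K : Type) [Field K] [Algebra F K] [FiniteDimensional F K] (_ : K →ₐ[F] B),
      finrank F K ∣ k) :
    ∃ x : End F V, IsTestElement x k := by
  let ρ : B →ₐ[F] End F V := (e.conjAlgEquiv F : End F B →ₐ[F] End F V).comp (Algebra.lmul F B)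
  have hρ : ∀ b c, ρ b (e c) = e (b * c) := fun b c => by
    simp [ρ]
  have hρinj : Function.Injective ρ := fun b c h => by
    have := congrArg (fun f : End F V => f (e 1)) h
    simpa [hρ] using this
  have hideal : ∀ U : Submodule F V, (∀ u ∈ U, ρ θ u ∈ U) →
      ∃ I : Ideal B, (I.restrictScalars F).map (e : B →ₗ[F] V) = U := by
    intro U hU
    let S : NonUnitalSubring B :=
      { carrier := {b | ∀ u ∈ U, ρ b u ∈ U}
        zero_mem' := fun u _ => by simp
        add_mem' := fun ha hb u hu => by simpa using U.add_mem (ha u hu) (hb u hu)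
        neg_mem' := fun ha u hu => by simpa using ha u hu
        mul_mem' := fun ha hb u hu => by simpa using ha _ (hb u hu) }
    have hS : S = ⊤ := hθ S hU
    refine ⟨{ U.comap (e : B →ₗ[F] V) with
      smul_mem' := fun b c hc => ?_ }, ?_⟩
    · have hb : b ∈ S := hS ▸ trivial
      have := hb (e c) hc
      rwa [hρ] at this
    · ext v
      constructor
      · rintro ⟨b, hb, rfl⟩
        exact hb
      · intro hv
        exact ⟨e.symm v, by simpa using hv, by simp⟩
  have hfr : ∀ I : Ideal B, finrank F ((I.restrictScalars F).map (e : B →ₗ[F] V)) =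
      finrank F (I.restrictScalars F) := fun I => LinearEquiv.finrank_map_eq e _
  have hcomm : ∀ f : End F V, Commute f (ρ θ) → f ∈ ρ.range := by
    intro f hf
    have hS := hθ ((NonUnitalSubring.centralizer {f}).comap (ρ : B →ₙ+* End F V)) (by
      rw [NonUnitalSubring.mem_comap, NonUnitalSubring.mem_centralizer_iff]
      rintro g rfl
      exact hf)
    -- A map commuting with all of `B` is determined by its value at 1.
    refine ⟨e.symm (f (e 1)), ?_⟩
    ext v
    obtain ⟨b, rfl⟩ := e.surjective v
    have hb : b ∈ (NonUnitalSubring.centralizer {f}).comap (ρ : B →ₙ+* End F V) := hS ▸ trivial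
    rw [NonUnitalSubring.mem_comap, NonUnitalSubring.mem_centralizer_iff] at hb
    have hb' : f (ρ b (e 1)) = ρ b (f (e 1)) :=
      congrArg (fun g : End F V => g (e 1)) (hb f rfl)
    rw [hρ, mul_one] at hb'
    change ρ _ (e b) = f (e b)
    rw [hb', hρ, mul_comm, ← hρ, e.apply_symm_apply]
  have hlift : ∀ (K : Type) [Field K] [Algebra F K],
      ∃ j : {φ : K →ₐ[F] End F V // ∀ a, Commute (φ a) (ρ θ)} → (K →ₐ[F] B),
        Function.Injective j := by
    intro K _ _
    refine ⟨fun φ => ((AlgEquiv.ofInjective ρ hρinj).symm : ρ.range →ₐ[F] B).comp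
      (φ.1.codRestrict ρ.range fun a => hcomm _ (φ.2 a)), fun φ ψ h => ?_⟩
    refine Subtype.ext (AlgHom.ext fun a => ?_)
    have := DFunLike.congr_fun h a
    simpa [Subtype.ext_iff] using this
  refine ⟨ρ θ, ?_, ?_, ?_, ?_, ?_⟩
  · intro S hS r
    have := hθ (S.comap (ρ : B →ₙ+* End F V)) hS
    have hr : algebraMap F B r ∈ S.comap (ρ : B →ₙ+* End F V) := this ▸ trivial
    rw [NonUnitalSubring.mem_comap] at hr
    have h' : ρ (algebraMap F B r) = algebraMap F (End F V) r := ρ.commutes r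
    rw [← h']
    exact hr
  · intro U hU hb ht
    obtain ⟨I, rfl⟩ := hideal U hU
    rw [hfr, ← e.finrank_eq]
    refine h1 I ?_ ?_
    · rintro rfl
      simp at hb
    · rintro rfl
      simp at ht
  · intro U W hU hW hUW
    by_cases hUb : U = ⊥
    · rw [hUb, finrank_bot] at hUW
      rw [hUb, Submodule.finrank_eq_zero.1 hUW.symm]
    by_cases hUt : U = ⊤
    · rw [hUt, finrank_top] at hUW
      rw [hUt, Submodule.eq_top_of_finrank_eq hUW.symm]
    by_cases hWb : W = ⊥
    · rw [hWb, finrank_bot] at hUW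
      exact absurd (Submodule.finrank_eq_zero.1 hUW) hUb
    by_cases hWt : W = ⊤
    · rw [hWt, finrank_top] at hUW
      exact absurd (Submodule.eq_top_of_finrank_eq hUW) hUt
    obtain ⟨I, rfl⟩ := hideal U hU
    obtain ⟨J, rfl⟩ := hideal W hW
    rw [hfr, hfr] at hUW
    rw [h2 I J ?_ ?_ ?_ ?_ hUW]
    · rintro rfl; simp at hUb
    · rintro rfl; simp at hUt
    · rintro rfl; simp at hWb
    · rintro rfl; simp at hWt
  · intro K _ _ _
    obtain ⟨j, hj⟩ := hlift K
    have : Finite (K →ₐ[F] B) := by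
      have : Finite K := Module.finite_of_finite F
      have : Finite B := Module.finite_of_finite F
      exact Finite.of_injective (fun f => (f : K → B)) DFunLike.coe_injective
    exact (Nat.card_le_card_of_injective j hj).trans (h3 K)
  · intro K _ _ _ φ hφ
    obtain ⟨j, hj⟩ := hlift K
    exact h4 K (j ⟨φ, hφ⟩)

/-- Exponents start at 1 because the subrings in question need not contain the identity. -/
theorem exists_forall_eq_pow_succ (L : Type*) [Field L] [Finite L] :
    ∃ θ : L, θ ≠ 0 ∧ ∀ y ≠ 0, ∃ i : ℕ, θ ^ (i + 1) = y := by
  obtain ⟨g, hg⟩ := IsCyclic.exists_generator (α := Lˣ)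
  refine ⟨g, g.ne_zero, fun y hy => ?_⟩
  obtain ⟨i, hi⟩ := mem_powers_iff_mem_zpowers.2 (hg (Units.mk0 y hy * g⁻¹))
  refine ⟨i, ?_⟩
  have : g ^ (i + 1) = Units.mk0 y hy := by
    rw [pow_succ]; simp only at hi; rw [hi]; simp
  simpa using congrArg Units.val this

theorem NonUnitalSubring.pow_succ_mem {B : Type*} [Ring B] (S : NonUnitalSubring B) {x : B}
    (hx : x ∈ S) (i : ℕ) : x ^ (i + 1) ∈ S := by
  induction i with
  | zero => simpa
  | succ i ih => rw [pow_succ]; exact S.mul_mem ih hx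

omit [Finite F] in
theorem natCard_algHom_le_finrank (K L : Type*) [Field K] [Field L] [Algebra F K] [Algebra F L]
    [Finite L] : Nat.card (K →ₐ[F] L) ≤ finrank F K := by
  by_cases h : Nonempty (K →ₐ[F] L)
  · exact (FiniteField.natCard_algHom_of_finrank_dvd
      (FiniteField.nonempty_algHom_iff_finrank_dvd.1 h)).le
  · rw [not_nonempty_iff] at h
    simp

end

section

variable {F V : Type*} [Field F] [Finite F] [AddCommGroup V] [Module F V] [FiniteDimensional F V]

theorem exists_isTestElement_of_field (L : Type*) [Field L] [Algebra F L] [FiniteDimensional F L]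
    (hL : finrank F L = finrank F V) : ∃ x : End F V, IsTestElement x 0 := by
  have : Finite L := Module.finite_of_finite F
  obtain ⟨θ, h0, hθ⟩ := exists_forall_eq_pow_succ L
  refine isTestElement_of_algebra (LinearEquiv.ofFinrankEq L V hL) θ ?_ 0 ?_ ?_ ?_ ?_
  · intro S hS
    refine eq_top_iff.2 fun y _ => ?_
    by_cases hy : y = 0
    · exact hy ▸ S.zero_mem
    · obtain ⟨i, rfl⟩ := hθ y hy
      exact S.pow_succ_mem hS i
  · intro I hb ht
    exact absurd (Ideal.eq_bot_or_top I) (by tauto)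
  · intro I J hb ht
    exact absurd (Ideal.eq_bot_or_top I) (by tauto)
  · intro K _ _ _
    simpa using natCard_algHom_le_finrank (F := F) K L
  · intro K _ _ _ _
    exact dvd_zero _

/-- Here B = L × M. The strict inequality of degrees tells its two proper nonzero ideals apart by
dimension, and lets a polynomial without constant term separate the two coordinates. -/
theorem exists_isTestElement_of_prod (L M : Type*) [Field L] [Algebra F L]
    [FiniteDimensional F L] [Field M] [Algebra F M] [FiniteDimensional F M]
    (hlt : finrank F L < finrank F M) (hLM : finrank F L + finrank F M = finrank F V) :
    ∃ x : End F V, IsTestElement x (finrank F L) := by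
  have : Finite L := Module.finite_of_finite F
  have : Finite M := Module.finite_of_finite F
  obtain ⟨α, hα0, hα⟩ := exists_forall_eq_pow_succ L
  obtain ⟨β, hβ0, hβ⟩ := exists_forall_eq_pow_succ M
  have hpos : 0 < finrank F L := finrank_pos
  have hLI : finrank F ((Ideal.prod ⊤ ⊥ : Ideal (L × M)).restrictScalars F) = finrank F L := by
    have : (Ideal.prod ⊤ ⊥ : Ideal (L × M)).restrictScalars F =
        LinearMap.range (LinearMap.inl F L M) := by
      ext x
      simp [Prod.ext_iff, eq_comm]
    rw [this, LinearMap.finrank_range_of_inj LinearMap.inl_injective]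
  have hMI : finrank F ((Ideal.prod ⊥ ⊤ : Ideal (L × M)).restrictScalars F) = finrank F M := by
    have : (Ideal.prod ⊥ ⊤ : Ideal (L × M)).restrictScalars F =
        LinearMap.range (LinearMap.inr F L M) := by
      ext x
      simp [Prod.ext_iff, eq_comm]
    rw [this, LinearMap.finrank_range_of_inj LinearMap.inr_injective]
  have hI : ∀ I : Ideal (L × M), I ≠ ⊥ → I ≠ ⊤ → I = Ideal.prod ⊤ ⊥ ∨ I = Ideal.prod ⊥ ⊤ := by
    intro I hb ht
    have h := Ideal.ideal_prod_eq I
    rcases Ideal.eq_bot_or_top (I.map (RingHom.fst L M)) with h1 | h1 <;>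
    rcases Ideal.eq_bot_or_top (I.map (RingHom.snd L M)) with h2 | h2 <;>
    rw [h1, h2] at h
    · exact absurd (h.trans (by ext; simp [Prod.ext_iff])) hb
    · exact Or.inr h
    · exact Or.inl h
    · exact absurd (h.trans (by ext; simp)) ht
  refine isTestElement_of_algebra (LinearEquiv.ofFinrankEq (L × M) V (by simpa using hLM)) (α, β)
    ?_ _ ?_ ?_ ?_ ?_
  · intro S hS
    have hcard : Nat.card L < Nat.card M := by
      rw [Module.natCard_eq_pow_finrank (K := F) (V := L),
        Module.natCard_eq_pow_finrank (K := F) (V := M)]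
      exact Nat.pow_lt_pow_right Finite.one_lt_card hlt
    -- The polynomial X^|L| - X vanishes on `L`. It does not vanish at β, since otherwise all of the
    -- larger field `M` would consist of its roots.
    have hγ : ((0 : L), β ^ Nat.card L - β) ∈ S := by
      have h1 := S.sub_mem (S.pow_succ_mem hS (Nat.card L - 1)) hS
      rw [Nat.sub_add_cancel Nat.card_pos, Prod.pow_mk, Prod.mk_sub_mk] at h1
      have : Fintype L := Fintype.ofFinite L
      rwa [Nat.card_eq_fintype_card, FiniteField.pow_card, sub_self,
        ← Nat.card_eq_fintype_card] at h1
    have hγ0 : β ^ Nat.card L - β ≠ 0 := by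
      intro h
      have hall : ∀ y : M, y ^ Nat.card L = y := by
        intro y
        by_cases hy : y = 0
        · rw [hy, zero_pow Nat.card_pos.ne']
        · obtain ⟨i, rfl⟩ := hβ y hy
          rw [← pow_mul, mul_comm, pow_mul, sub_eq_zero.1 h]
      have : Fintype M := Fintype.ofFinite M
      have hdeg := Polynomial.card_roots' (Polynomial.X ^ Nat.card L - Polynomial.X :
        Polynomial M)
      rw [FiniteField.X_pow_card_sub_X_natDegree_eq M Finite.one_lt_card] at hdeg
      have hsub : (Finset.univ : Finset M).val ≤
          (Polynomial.X ^ Nat.card L - Polynomial.X : Polynomial M).roots := by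
        rw [Multiset.le_iff_subset Finset.univ.nodup]
        intro y _
        rw [Polynomial.mem_roots (FiniteField.X_pow_card_sub_X_ne_zero M Finite.one_lt_card)]
        simp [hall y]
      have := (Multiset.card_le_card hsub).trans hdeg
      rw [Finset.card_val, Finset.card_univ, ← Nat.card_eq_fintype_card] at this
      omega
    have hright : ∀ y : M, ((0 : L), y) ∈ S := by
      intro y
      by_cases hy : y = 0
      · exact hy ▸ S.zero_mem
      · obtain ⟨i, hi⟩ := hβ (y / (β ^ Nat.card L - β)) (div_ne_zero hy hγ0)
        have := S.mul_mem (S.pow_succ_mem hS i) hγ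
        rw [Prod.pow_mk, Prod.mk_mul_mk, mul_zero, hi, div_mul_cancel₀ _ hγ0] at this
        exact this
    have hleft : ∀ y : L, (y, (0 : M)) ∈ S := by
      intro y
      by_cases hy : y = 0
      · exact hy ▸ S.zero_mem
      · obtain ⟨i, hi⟩ := hα y hy
        have := S.sub_mem (S.pow_succ_mem hS i) (hright (β ^ (i + 1)))
        rw [Prod.pow_mk, Prod.mk_sub_mk, sub_self, sub_zero, hi] at this
        exact this
    refine eq_top_iff.2 fun y _ => ?_
    have := S.add_mem (hleft y.1) (hright y.2)
    rwa [Prod.mk_add_mk, add_zero, zero_add] at this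
  · intro I hb ht
    rcases hI I hb ht with rfl | rfl
    · exact Or.inl hLI
    · rw [hMI, finrank_prod]; omega
  · intro I J hb ht hb' ht' h
    rcases hI I hb ht with rfl | rfl <;> rcases hI J hb' ht' with rfl | rfl
    · rfl
    · rw [hLI, hMI] at h; omega
    · rw [hLI, hMI] at h; omega
    · rfl
  · intro K _ _ _
    have : Finite (K →ₐ[F] L) := by
      have : Finite K := Module.finite_of_finite F
      exact Finite.of_injective (fun f => (f : K → L)) DFunLike.coe_injective
    have : Finite (K →ₐ[F] M) := by
      have : Finite K := Module.finite_of_finite F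
      exact Finite.of_injective (fun f => (f : K → M)) DFunLike.coe_injective
    rw [if_neg hpos.ne']
    calc Nat.card (K →ₐ[F] L × M) ≤ Nat.card ((K →ₐ[F] L) × (K →ₐ[F] M)) :=
          Nat.card_le_card_of_injective
            (fun f => ((AlgHom.fst F L M).comp f, (AlgHom.snd F L M).comp f)) (by
              intro f g h
              ext a
              · exact DFunLike.congr_fun (congrArg Prod.fst h) a
              · exact DFunLike.congr_fun (congrArg Prod.snd h) a)
      _ ≤ finrank F K ^ 2 := by
          rw [Nat.card_prod, sq]
          exact Nat.mul_le_mul (natCard_algHom_le_finrank K L) (natCard_algHom_le_finrank K M)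
  · intro K _ _ _ φ
    exact FiniteField.nonempty_algHom_iff_finrank_dvd.1 ⟨(AlgHom.fst F L M).comp φ⟩

open TrivSqZeroExt in
-- For n = 2k two field factors of degree k would give two ideals of equal dimension. The dual
-- numbers over `L` have a single proper nonzero ideal.
theorem exists_isTestElement_of_trivSqZeroExt (L : Type*) [Field L] [Algebra F L]
    [FiniteDimensional F L] (hL : finrank F L + finrank F L = finrank F V) :
    ∃ x : End F V, IsTestElement x (finrank F L) := by
  have : Finite L := Module.finite_of_finite F
  obtain ⟨α, hα0, hα⟩ := exists_forall_eq_pow_succ L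
  have hpos : 0 < finrank F L := finrank_pos
  have hfinrank : finrank F (TrivSqZeroExt L L) = finrank F L + finrank F L :=
    finrank_prod (R := F) (M := L) (M' := L)
  have : FiniteDimensional F (TrivSqZeroExt L L) :=
    inferInstanceAs (FiniteDimensional F (L × L))
  have hI : ∀ I : Ideal (TrivSqZeroExt L L), I ≠ ⊥ → I ≠ ⊤ →
      I = RingHom.ker (fstHom L L L : TrivSqZeroExt L L →+* L) := by
    intro I hb ht
    have hle : ∀ x ∈ I, x.fst = 0 := by
      intro x hx
      by_contra h0
      exact ht (Ideal.eq_top_of_isUnit_mem I hx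
        ((TrivSqZeroExt.isUnit_iff_isUnit_fst).2 (isUnit_iff_ne_zero.2 h0)))
    obtain ⟨x, hx, hx0⟩ := Submodule.exists_mem_ne_zero_of_ne_bot hb
    have hs : x.snd ≠ 0 := fun h => hx0 (TrivSqZeroExt.ext (hle x hx) h)
    ext y
    constructor
    · exact hle y
    · intro hy
      have hy' : y.fst = 0 := hy
      have := I.mul_mem_left (inl (y.snd / x.snd)) hx
      convert this using 1
      ext
      · simp [hy', hle x hx]
      · simp [hs]
  have hker : finrank F ((RingHom.ker (fstHom L L L : TrivSqZeroExt L L →+* L)).restrictScalars F)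
      = finrank F L := by
    let j : L →ₗ[F] TrivSqZeroExt L L :=
      { toFun := inr, map_add' := inr_add L, map_smul' := fun r x => inr_smul L r x }
    have : (RingHom.ker (fstHom L L L : TrivSqZeroExt L L →+* L)).restrictScalars F =
        LinearMap.range j := by
      ext x
      constructor
      · intro hx
        exact ⟨x.snd, Prod.ext (Eq.symm hx) rfl⟩
      · rintro ⟨y, rfl⟩
        rfl
    rw [this]
    exact LinearMap.finrank_range_of_inj inr_injective
  refine isTestElement_of_algebra
    (LinearEquiv.ofFinrankEq (TrivSqZeroExt L L) V (hfinrank.trans hL)) (inl α + inr 1)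
    ?_ _ ?_ ?_ ?_ ?_
  · intro S hS
    -- Raising α + ε to the power |L| fixes α and kills ε, because |L| is zero in `L`.
    have hαmem : (inl α : TrivSqZeroExt L L) ∈ S := by
      have h1 := S.pow_succ_mem hS (Nat.card L - 1)
      rw [Nat.sub_add_cancel Nat.card_pos] at h1
      convert h1 using 1
      have : Fintype L := Fintype.ofFinite L
      ext
      · simp [Nat.card_eq_fintype_card, FiniteField.pow_card]
      · rw [TrivSqZeroExt.snd_pow]
        simp [← Nat.cast_smul_eq_nsmul L]
    have hinl : ∀ y : L, (inl y : TrivSqZeroExt L L) ∈ S := by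
      intro y
      by_cases hy : y = 0
      · rw [hy, inl_zero]; exact S.zero_mem
      · obtain ⟨i, rfl⟩ := hα y hy
        have h : (inl (α ^ (i + 1)) : TrivSqZeroExt L L) = inl α ^ (i + 1) :=
          map_pow (inlHom L L) α (i + 1)
        exact h ▸ S.pow_succ_mem hαmem i
    have hε : (inr 1 : TrivSqZeroExt L L) ∈ S := by
      have := S.sub_mem hS hαmem
      rwa [add_sub_cancel_left] at this
    refine eq_top_iff.2 fun y _ => ?_
    have := S.add_mem (hinl y.fst) (S.mul_mem (hinl y.snd) hε)
    convert this using 1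
    ext <;> simp
  · intro I hb ht
    rw [hI I hb ht]
    exact Or.inl hker
  · intro I J hb ht hb' ht' _
    rw [hI I hb ht, hI J hb' ht']
  · intro K _ _ _
    rw [if_neg hpos.ne']
    have : Finite (K →ₐ[F] L) := by
      have : Finite K := Module.finite_of_finite F
      exact Finite.of_injective (fun f => (f : K → L)) DFunLike.coe_injective
    have : Algebra.FormallyUnramified F K := Algebra.FormallyUnramified.of_isSeparable F K
    calc Nat.card (K →ₐ[F] TrivSqZeroExt L L) ≤ Nat.card (K →ₐ[F] L) :=
          Nat.card_le_card_of_injective (fun f => (fstHom F L L).comp f) (by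
            intro f g h
            -- Separability of `K` makes lifts through the square-zero kernel unique, so there are
            -- no more embeddings than into `L`.
            refine Algebra.FormallyUnramified.lift_unique' (fstHom F L L) ⟨2, ?_⟩ f g h
            rw [Ideal.zero_eq_bot, eq_bot_iff, sq, Ideal.mul_le]
            intro a ha b hb
            have ha' : a.fst = 0 := ha
            have hb' : b.fst = 0 := hb
            rw [Ideal.mem_bot]
            ext <;> simp [ha', hb'])
      _ ≤ finrank F K := natCard_algHom_le_finrank K L
      _ ≤ finrank F K ^ 2 := Nat.le_self_pow two_ne_zero _
  · intro K _ _ _ φ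
    exact FiniteField.nonempty_algHom_iff_finrank_dvd.1 ⟨(fstHom F L L).comp φ⟩

theorem exists_isTestElement (c : ℕ) [Fact c.Prime] [CharP F c] (k : ℕ) (hV : 0 < finrank F V)
    (hk : 2 * k ≤ finrank F V) : ∃ x : End F V, IsTestElement x k := by
  rcases Nat.eq_zero_or_pos k with rfl | hpos
  · have : NeZero (finrank F V) := ⟨hV.ne'⟩
    exact exists_isTestElement_of_field (FiniteField.Extension F c (finrank F V))
      (FiniteField.finrank_extension ..)
  have : NeZero k := ⟨hpos.ne'⟩
  have hfr : finrank F (FiniteField.Extension F c k) = k := FiniteField.finrank_extension ..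
  rcases hk.lt_or_eq with hlt | heq
  · have : NeZero (finrank F V - k) := ⟨by omega⟩
    have hfr' : finrank F (FiniteField.Extension F c (finrank F V - k)) = finrank F V - k :=
      FiniteField.finrank_extension ..
    have := exists_isTestElement_of_prod (F := F) (V := V) (FiniteField.Extension F c k)
      (FiniteField.Extension F c (finrank F V - k)) (by omega) (by omega)
    rwa [hfr] at this
  · have := exists_isTestElement_of_trivSqZeroExt (F := F) (V := V)
      (FiniteField.Extension F c k) (by omega)
    rwa [hfr] at this

end

/-! ### Numerical estimates for primes p > b -/

section Arithmetic

theorem quarter_mul_pow_le_prod (q n : ℕ) (hq : 2 ≤ q) :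
    (q ^ n) ^ n ≤ 4 * ∏ i ∈ Finset.range n, (q ^ n - q ^ i) := by
  have hq0 : (0 : ℚ) < q := by exact_mod_cast (by omega : 0 < q)
  have hq2 : (2 : ℚ) ≤ q := by exact_mod_cast hq
  -- The extra term 1/2^(m+2) makes the bound 1/4 inductive: (1/4 + t)(1 - t) ≥ 1/4 + t/2 for 0 ≤ t
  -- ≤ 1/4.
  have key : ∀ m : ℕ, (1 / 4 + 1 / 2 ^ (m + 2) : ℚ) ≤
      ∏ j ∈ Finset.range (m + 1), (1 - 1 / (q : ℚ) ^ (j + 1)) := by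
    intro m
    induction m with
    | zero =>
      have : 1 / (q : ℚ) ≤ 1 / 2 := one_div_le_one_div_of_le (by norm_num) hq2
      simp only [zero_add, Finset.range_one, Finset.prod_singleton, pow_one]
      linarith
    | succ m ih =>
      rw [Finset.prod_range_succ]
      have h1 : 1 / (q : ℚ) ^ (m + 1 + 1) ≤ 1 / 2 ^ (m + 2) :=
        one_div_le_one_div_of_le (by positivity) (pow_le_pow_left₀ (by norm_num) hq2 _)
      have h2 : (1 / 2 ^ (m + 2) : ℚ) ≤ 1 / 4 := by
        refine one_div_le_one_div_of_le (by norm_num) ?_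
        calc (4 : ℚ) = 2 ^ 2 := by norm_num
          _ ≤ 2 ^ (m + 2) := pow_le_pow_right₀ (by norm_num) (by omega)
      have h3 : (1 / 2 ^ (m + 1 + 2) : ℚ) = 1 / 2 ^ (m + 2) / 2 := by
        rw [show m + 1 + 2 = (m + 2) + 1 by ring, pow_succ]; field_simp
      have h4 : (0 : ℚ) < 1 / 2 ^ (m + 2) := by positivity
      rw [h3]
      set t : ℚ := 1 / 2 ^ (m + 2)
      calc 1 / 4 + t / 2 ≤ (1 / 4 + t) * (1 - t) := by nlinarith
        _ ≤ _ := mul_le_mul ih (by linarith) (by linarith) (by linarith)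
  have hprod : ((∏ i ∈ Finset.range n, (q ^ n - q ^ i) : ℕ) : ℚ) =
      ((q : ℚ) ^ n) ^ n * ∏ j ∈ Finset.range n, (1 - 1 / (q : ℚ) ^ (j + 1)) := by
    have hconst : ((q : ℚ) ^ n) ^ n = ∏ i ∈ Finset.range n, (q : ℚ) ^ n := by simp
    rw [← Finset.prod_range_reflect (fun j => (1 - 1 / (q : ℚ) ^ (j + 1))), Nat.cast_prod,
      hconst, ← Finset.prod_mul_distrib]
    refine Finset.prod_congr rfl fun i hi => ?_
    rw [Finset.mem_range] at hi
    rw [Nat.cast_sub (Nat.pow_le_pow_right (by omega) hi.le), mul_sub, mul_one]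
    push_cast
    congr 1
    rw [show n - 1 - i + 1 = n - i by omega, pow_sub₀ _ hq0.ne' hi.le]
    field_simp
  rcases Nat.eq_zero_or_pos n with rfl | hn
  · simp
  obtain ⟨m, rfl⟩ : ∃ m, n = m + 1 := ⟨n - 1, by omega⟩
  have h4 : (0 : ℚ) < 1 / 2 ^ (m + 2) := by positivity
  have := key m
  have : ((q : ℚ) ^ (m + 1)) ^ (m + 1) ≤
      4 * ((∏ i ∈ Finset.range (m + 1), (q ^ (m + 1) - q ^ i) : ℕ) : ℚ) := by
    rw [hprod]
    have h5 : (0 : ℚ) < ((q : ℚ) ^ (m + 1)) ^ (m + 1) := by positivity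
    nlinarith
  exact_mod_cast this

theorem sixty_four_mul_sq_le (p : ℕ) (hp : 3 ≤ p) : 64 * p ^ 2 ≤ 9 * 4 ^ p := by
  induction p, hp using Nat.le_induction with
  | base => norm_num
  | succ p hp ih =>
    rw [pow_succ 4]
    nlinarith

/-- The right product dominates the left one factor by factor and has at least one factor more. The
last one alone, at least (3/4)q^n, outweighs the constants since q^n ≥ 2p. -/
theorem sixteen_mul_prod_le (q n b p : ℕ) (hq : 2 ≤ q) (hb : 2 ≤ b) (hbp : b < p)
    (hbn : b ∣ n) (hpn : p ∣ n) (hn : 2 * p ≤ n) :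
    16 * p * ∏ i ∈ Finset.range (n / p), (q ^ n - q ^ (p * i)) ≤
      7 * b * ∏ i ∈ Finset.range (n / b), (q ^ n - q ^ (b * i)) := by
  obtain ⟨m, hm⟩ := hpn
  obtain ⟨l, hl⟩ := hbn
  have hm' : n / p = m := by rw [hm, Nat.mul_div_cancel_left _ (by omega)]
  have hl' : n / b = l := by rw [hl, Nat.mul_div_cancel_left _ (by omega)]
  rw [hm', hl']
  have hml : m < l := by
    by_contra! h
    have hm0 : 0 < m := Nat.pos_of_ne_zero (by rintro rfl; omega)
    have h1 : b * l ≤ b * m := Nat.mul_le_mul_left b h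
    have h2 : b * m < p * m := Nat.mul_lt_mul_of_pos_right hbp hm0
    omega
  have h1 : ∏ i ∈ Finset.range m, (q ^ n - q ^ (p * i)) ≤
      ∏ i ∈ Finset.range m, (q ^ n - q ^ (b * i)) := by
    refine Finset.prod_le_prod' fun i _ => Nat.sub_le_sub_left ?_ _
    exact Nat.pow_le_pow_right (by omega) (Nat.mul_le_mul_right i hbp.le)
  have h2 : (∏ i ∈ Finset.range m, (q ^ n - q ^ (b * i))) * (q ^ n - q ^ (b * (l - 1))) ≤
      ∏ i ∈ Finset.range l, (q ^ n - q ^ (b * i)) := by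
    obtain ⟨l', rfl⟩ : ∃ l', l = l' + 1 := ⟨l - 1, by omega⟩
    rw [Finset.prod_range_succ, Nat.add_sub_cancel]
    refine Nat.mul_le_mul_right _ ?_
    refine Finset.prod_le_prod_of_subset_of_one_le' (Finset.range_mono (by omega)) ?_
    intro i hi _
    rw [Finset.mem_range] at hi
    have : q ^ (b * i) < q ^ n := Nat.pow_lt_pow_right (by omega) (by rw [hl]; nlinarith)
    omega
  have h3 : 4 * q ^ (b * (l - 1)) ≤ q ^ n := by
    have : n = b * (l - 1) + b := by
      rw [hl]; obtain ⟨l', rfl⟩ : ∃ l', l = l' + 1 := ⟨l - 1, by omega⟩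
      rw [Nat.add_sub_cancel]; ring
    rw [this, pow_add, mul_comm]
    refine Nat.mul_le_mul_left _ ?_
    calc 4 = 2 ^ 2 := rfl
      _ ≤ q ^ 2 := Nat.pow_le_pow_left hq 2
      _ ≤ q ^ b := Nat.pow_le_pow_right (by omega) hb
  have h4 : 2 * p ≤ q ^ n := hn.trans (Nat.lt_pow_self (by omega)).le
  have h5 : 16 * p ≤ 7 * b * (q ^ n - q ^ (b * (l - 1))) := by
    have : 3 * q ^ n ≤ 4 * (q ^ n - q ^ (b * (l - 1))) := by omega
    nlinarith
  calc 16 * p * ∏ i ∈ Finset.range m, (q ^ n - q ^ (p * i))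
      ≤ 7 * b * (q ^ n - q ^ (b * (l - 1))) * ∏ i ∈ Finset.range m, (q ^ n - q ^ (b * i)) :=
        Nat.mul_le_mul h5 h1
    _ = 7 * b * ((∏ i ∈ Finset.range m, (q ^ n - q ^ (b * i))) *
        (q ^ n - q ^ (b * (l - 1)))) := by ring
    _ ≤ _ := Nat.mul_le_mul_left _ h2

theorem sixteen_mul_sq_mul_pow_le (q n p N : ℕ) (hq : 2 ≤ q) (hp : 3 ≤ p)
    (hpn : p ∣ n) (hn : 2 * p ≤ n)
    (hN : N * ∏ i ∈ Finset.range (n / p), (q ^ n - q ^ (p * i)) =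
      ∏ i ∈ Finset.range n, (q ^ n - q ^ i)) :
    16 * p ^ 2 * (q ^ n) ^ (n / 2) ≤ 9 * N := by
  obtain ⟨m, hm⟩ := hpn
  have hm' : n / p = m := by rw [hm, Nat.mul_div_cancel_left _ (by omega)]
  rw [hm'] at hN
  have h3m : 3 * m ≤ n := by rw [hm]; exact Nat.mul_le_mul_right m hp
  have hX : 0 < q ^ n := Nat.pow_pos (by omega)
  have hP : ∏ i ∈ Finset.range m, (q ^ n - q ^ (p * i)) ≤ (q ^ n) ^ m := by
    calc _ ≤ ∏ i ∈ Finset.range m, q ^ n := Finset.prod_le_prod' fun i _ => Nat.sub_le _ _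
      _ = _ := by simp
  have h1 : (q ^ n) ^ (n - m) ≤ 4 * N := by
    refine Nat.le_of_mul_le_mul_right ?_ (Nat.pow_pos (n := m) hX)
    rw [← pow_add, Nat.sub_add_cancel (by omega)]
    calc (q ^ n) ^ n ≤ 4 * ∏ i ∈ Finset.range n, (q ^ n - q ^ i) :=
          quarter_mul_pow_le_prod q n hq
      _ = 4 * N * ∏ i ∈ Finset.range m, (q ^ n - q ^ (p * i)) := by rw [← hN]; ring
      _ ≤ _ := Nat.mul_le_mul_left _ hP
  -- From 3m ≤ n and n ≥ 6 one gets n/2 + 1 ≤ n - m; the spare factor q^n absorbs 64p².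
  have h2 : (q ^ n) ^ (n / 2) * q ^ n ≤ (q ^ n) ^ (n - m) := by
    rw [← pow_succ]
    exact Nat.pow_le_pow_right hX (by omega)
  have h3 : 64 * p ^ 2 ≤ 9 * q ^ n := by
    refine (sixty_four_mul_sq_le p hp).trans (Nat.mul_le_mul_left _ ?_)
    calc 4 ^ p = 2 ^ (2 * p) := by rw [pow_mul]; norm_num
      _ ≤ q ^ (2 * p) := Nat.pow_le_pow_left hq _
      _ ≤ q ^ n := Nat.pow_le_pow_right (by omega) hn
  have h4 : 64 * p ^ 2 * (q ^ n) ^ (n / 2) ≤ 9 * ((q ^ n) ^ (n / 2) * q ^ n) := by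
    calc _ ≤ 9 * q ^ n * (q ^ n) ^ (n / 2) := Nat.mul_le_mul_right _ h3
      _ = _ := by ring
  have h5 := h4.trans (Nat.mul_le_mul_left 9 (h2.trans h1))
  linarith

end Arithmetic

/-! ### A crude bound for the number of subspaces -/

section

variable {F V : Type*} [Field F] [Finite F] [AddCommGroup V] [Module F V] [FiniteDimensional F V]

theorem Submodule.card_finrank_le (m : ℕ) :
    Nat.card {X : Submodule F V // finrank F X ≤ m} ≤ (Nat.card F ^ finrank F V) ^ m := by
  have : Finite V := Module.finite_of_finite F
  have hc : Nat.card (Fin m → V) = (Nat.card F ^ finrank F V) ^ m := by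
    rw [Nat.card_fun, ← Module.natCard_eq_pow_finrank (K := F) (V := V)]; simp
  rw [← hc]
  have hex : ∀ X : {X : Submodule F V // finrank F X ≤ m},
      ∃ v : Fin m → V, Submodule.span F (Set.range v) = X.1 := by
    rintro ⟨X, hX⟩
    let B := finBasis F X
    -- A basis padded with zeros: each subspace of dimension at most m is the span of an m-tuple.
    refine ⟨fun i => if h : i.1 < finrank F X then (B ⟨i, h⟩ : V) else 0, le_antisymm ?_ ?_⟩
    · rw [Submodule.span_le]
      rintro _ ⟨i, rfl⟩
      dsimp only
      split_ifs
      · exact (B _).2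
      · exact X.zero_mem
    · have hspan : Submodule.span F (Set.range fun i => (B i : V)) = X := by
        have := congrArg (Submodule.map X.subtype) B.span_eq
        rwa [Submodule.map_span, Submodule.map_top, Submodule.range_subtype, ← Set.range_comp]
          at this
      refine hspan.ge.trans (Submodule.span_mono ?_)
      rintro _ ⟨i, rfl⟩
      exact ⟨⟨i, i.2.trans_le hX⟩, by simp⟩
  choose v hv using hex
  refine Nat.card_le_card_of_injective v fun X Y h => Subtype.ext ?_
  rw [← hv X, ← hv Y, h]

theorem Submodule.sum_card_finrank_eq_le (m : ℕ) (s : Finset ℕ) (hs : ∀ k ∈ s, k ≤ m) :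
    ∑ k ∈ s, Nat.card {X : Submodule F V // finrank F X = k} ≤
      (Nat.card F ^ finrank F V) ^ m := by
  classical
  have := Submodule.finite_of_finite_field (F := F) (V := V)
  refine le_trans ?_ (Submodule.card_finrank_le (F := F) (V := V) m)
  rw [← Finset.sum_coe_sort, ← Nat.card_sigma]
  refine Nat.card_le_card_of_injective (fun X => ⟨X.2.1, X.2.2.trans_le (hs _ X.1.2)⟩) ?_
  rintro ⟨⟨k, hk⟩, X, hX⟩ ⟨⟨l, hl⟩, Y, hY⟩ h
  have h' : X = Y := congrArg Subtype.val h
  simp only at hX hY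
  subst hX hY h'
  rfl

end

/-! ### The lower bound by weighted counting -/

section

variable {F V : Type*} [Field F] [Finite F] [AddCommGroup V] [Module F V] [FiniteDimensional F V]

/-- The number of `g ∈ GL(V)` with `g x g⁻¹ ∈ A`. -/
noncomputable def conjCount (x : End F V) (A : NonUnitalSubring (End F V)) : ℕ :=
  Nat.card {g : V ≃ₗ[F] V // g.conjAlgEquiv F x ∈ A}

/-- If g x g⁻¹ ∈ A, then g⁻¹U is the unique x-invariant subspace of its dimension. So all such g lie
in one fibre of the transitive action on subspaces of that dimension. -/
theorem mul_conjCount_le_of_invariant {x : End F V} {k : ℕ} (hx : IsTestElement x k)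
    (A : NonUnitalSubring (End F V)) (U : Submodule F V) (hU : ∀ a ∈ A, ∀ u ∈ U, a u ∈ U) :
    Nat.card {X : Submodule F V // finrank F X = finrank F U} * conjCount x A ≤
      Nat.card (V ≃ₗ[F] V) := by
  have hfin := LinearEquiv.finite_aut (F := F) (V := V)
  have hinv : ∀ g : V ≃ₗ[F] V, g.conjAlgEquiv F x ∈ A →
      ∀ u ∈ U.map (g.symm : V →ₗ[F] V), x u ∈ U.map (g.symm : V →ₗ[F] V) := by
    rintro g hg _ ⟨u, hu, rfl⟩
    exact ⟨_, hU _ hg u hu, by simp⟩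
  by_cases hne : ∃ g : V ≃ₗ[F] V, g.conjAlgEquiv F x ∈ A
  · obtain ⟨g₀, hg₀⟩ := hne
    have hdim : ∀ g : V ≃ₗ[F] V, finrank F (U.map (g.symm : V →ₗ[F] V)) = finrank F U :=
      fun g => LinearEquiv.finrank_map_eq g.symm U
    rw [← Submodule.card_map_fiber_mul_card (U.map (g₀.symm : V →ₗ[F] V)) U (hdim g₀), mul_comm]
    refine Nat.mul_le_mul_right _ (Nat.card_le_card_of_injective
      (fun g => ⟨g.1, ?_⟩) fun g h hgh => Subtype.ext (congrArg Subtype.val hgh :))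
    rw [hx.eq_of_finrank_eq _ _ (hinv g₀ hg₀) (hinv g.1 g.2) ((hdim g₀).trans (hdim g.1).symm),
      ← Submodule.map_comp]
    convert Submodule.map_id U
    ext v
    simp
  · have : IsEmpty {g : V ≃ₗ[F] V // g.conjAlgEquiv F x ∈ A} :=
      ⟨fun g => hne ⟨g.1, g.2⟩⟩
    simp [conjCount]

omit [Finite F] [FiniteDimensional F V] in
theorem conjCount_eq_zero_of_invariant {x : End F V} {k : ℕ} (hx : IsTestElement x k)
    (A : NonUnitalSubring (End F V)) (U : Submodule F V) (hU : ∀ a ∈ A, ∀ u ∈ U, a u ∈ U)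
    (hb : U ≠ ⊥) (ht : U ≠ ⊤) (h1 : finrank F U ≠ k) (h2 : finrank F U + k ≠ finrank F V) :
    conjCount x A = 0 := by
  have : IsEmpty {g : V ≃ₗ[F] V // g.conjAlgEquiv F x ∈ A} := by
    refine ⟨fun ⟨g, hg⟩ => ?_⟩
    have := hx.finrank_eq (U.map (g.symm : V →ₗ[F] V)) (by
      rintro _ ⟨u, hu, rfl⟩
      exact ⟨_, hU _ hg u hu, by simp⟩)
      (by simpa using hb) (by simpa using ht)
    rw [LinearEquiv.finrank_map_eq] at this
    tauto
  simp [conjCount]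

omit [Finite F] [FiniteDimensional F V] in
theorem commute_symm_conj {K : Type*} [Field K] [Algebra F K] (φ : K →ₐ[F] End F V)
    (x : End F V) (g : V ≃ₗ[F] V) (a : K) (h : Commute (φ a) (g.conjAlgEquiv F x)) :
    Commute (((g.symm.conjAlgEquiv F : End F V →ₐ[F] End F V).comp φ) a) x := by
  have h' := h.map (g.symm.conjAlgEquiv F)
  have hx : g.symm.conjAlgEquiv F (g.conjAlgEquiv F x) = x := by
    ext v
    simp
  rwa [hx] at h'

omit [Finite F] [FiniteDimensional F V] in
theorem conjCount_eq_zero_of_commute {K : Type} [Field K] [Algebra F K] [FiniteDimensional F K]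
    {x : End F V} {k : ℕ} (hx : IsTestElement x k) (A : NonUnitalSubring (End F V))
    (φ : K →ₐ[F] End F V) (hφ : ∀ a ∈ A, ∀ r, Commute (φ r) a) (hk : ¬ finrank F K ∣ k) :
    conjCount x A = 0 := by
  have : IsEmpty {g : V ≃ₗ[F] V // g.conjAlgEquiv F x ∈ A} :=
    ⟨fun ⟨g, hg⟩ => hk (hx.dvd_of_commute K _ fun a => commute_symm_conj φ x g a (hφ _ hg a))⟩
  simp [conjCount]

/-- If g x g⁻¹ ∈ A, then g⁻¹φg is an embedding commuting with x. There are few of these, and each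
arises from |GL(V)| / (number of embeddings) elements g. -/
theorem conjCount_mul_card_le {K : Type} [Field K] [Algebra F K] [FiniteDimensional F K]
    {x : End F V} {k : ℕ} (hx : IsTestElement x k) (A : NonUnitalSubring (End F V))
    (φ : K →ₐ[F] End F V) (hφ : ∀ a ∈ A, ∀ r, Commute (φ r) a) :
    conjCount x A * Nat.card (K →ₐ[F] End F V) ≤
      Nat.card (V ≃ₗ[F] V) * finrank F K ^ (if k = 0 then 1 else 2) := by
  have hfin := LinearEquiv.finite_aut (F := F) (V := V)
  have hfin' := AlgHomModule.finite_end (F := F) (V := V) (K := K)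
  let C := {ψ : K →ₐ[F] End F V // ∀ a, Commute (ψ a) x}
  have hC : Fintype C := Fintype.ofFinite C
  have hle : conjCount x A ≤ Nat.card (Σ ψ : C,
      {g : V ≃ₗ[F] V // (g.conjAlgEquiv F : End F V →ₐ[F] End F V).comp ψ.1 = φ}) := by
    refine Nat.card_le_card_of_injective
      (fun g => ⟨⟨(g.1.symm.conjAlgEquiv F : End F V →ₐ[F] End F V).comp φ,
        fun a => commute_symm_conj φ x g.1 a (hφ _ g.2 a)⟩, g.1, ?_⟩) ?_
    · ext r v
      simp
    · rintro ⟨g, hg⟩ ⟨h, hh⟩ hgh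
      have := congrArg (fun s : Σ ψ : C,
        {g : V ≃ₗ[F] V // (g.conjAlgEquiv F : End F V →ₐ[F] End F V).comp ψ.1 = φ} => s.2.1) hgh
      exact Subtype.ext this
  rw [Nat.card_sigma] at hle
  calc conjCount x A * Nat.card (K →ₐ[F] End F V)
      ≤ (∑ ψ : C, Nat.card {g : V ≃ₗ[F] V //
          (g.conjAlgEquiv F : End F V →ₐ[F] End F V).comp ψ.1 = φ}) *
          Nat.card (K →ₐ[F] End F V) := Nat.mul_le_mul_right _ hle
    _ = Nat.card C * Nat.card (V ≃ₗ[F] V) := by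
        rw [Finset.sum_mul]
        simp only [AlgHomModule.card_conj_fiber_mul_card]
        rw [Finset.sum_const, Finset.card_univ, smul_eq_mul, Nat.card_eq_fintype_card (α := C)]
    _ ≤ _ := by
        rw [mul_comm]
        exact Nat.mul_le_mul_left _ (hx.card_commute_le K)

omit [Finite F] [FiniteDimensional F V] in
theorem IsTestElement.algebraMap_mem_of_conj {x : End F V} {k : ℕ} (hx : IsTestElement x k)
    (A : NonUnitalSubring (End F V)) (g : V ≃ₗ[F] V) (hg : g.conjAlgEquiv F x ∈ A) (r : F) :
    algebraMap F (End F V) r ∈ A := by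
  have := hx.algebraMap_mem (A.comap (g.conjAlgEquiv F : End F V →ₙ+* End F V)) hg r
  rw [NonUnitalSubring.mem_comap] at this
  have h : g.conjAlgEquiv F (algebraMap F (End F V) r) = algebraMap F (End F V) r :=
    (g.conjAlgEquiv F).commutes r
  rw [← h]
  exact this

/-- The dimensions of the subspaces whose stabilizers occur in a minimal cover. -/
def coverDims (n b : ℕ) : Finset ℕ := (Finset.Icc 1 (n / 2)).filter fun k => ¬ b ∣ k

theorem mem_coverDims {n b k : ℕ} : k ∈ coverDims n b ↔ (1 ≤ k ∧ k ≤ n / 2) ∧ ¬ b ∣ k := by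
  simp [coverDims]

theorem weight_le_of_invariant (b : ℕ) (x : ℕ → End F V)
    (hx : ∀ k, 2 * k ≤ finrank F V → IsTestElement (x k) k)
    (A : NonUnitalSubring (End F V)) (U : Submodule F V) (hU : ∀ a ∈ A, ∀ u ∈ U, a u ∈ U)
    (hUb : U ≠ ⊥) (hUt : U ≠ ⊤) (N : ℚ) :
    N * conjCount (x 0) A + ∑ k ∈ coverDims (finrank F V) b,
      (Nat.card {X : Submodule F V // finrank F X = k} : ℚ) * conjCount (x k) A ≤
      Nat.card (V ≃ₗ[F] V) := by
  have h0 : finrank F U ≠ 0 := fun h => hUb (Submodule.finrank_eq_zero.1 h)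
  have hn : finrank F U < finrank F V := Submodule.finrank_lt hUt
  rw [conjCount_eq_zero_of_invariant (hx 0 (by simp)) A U hU hUb hUt h0 (by omega),
    Nat.cast_zero, mul_zero, zero_add]
  -- Only this test element can have conjugates in the stabilizer of `U`. In particular x_0 has
  -- none, so its weight `N` is arbitrary.
  set k₀ := min (finrank F U) (finrank F V - finrank F U) with hk₀
  have hzero : ∀ k ∈ coverDims (finrank F V) b, k ≠ k₀ →
      (Nat.card {X : Submodule F V // finrank F X = k} : ℚ) * conjCount (x k) A = 0 := by
    intro k hk hne
    have hk' := (mem_coverDims.1 hk).1.2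
    rw [conjCount_eq_zero_of_invariant (hx k (by omega)) A U hU hUb hUt (by omega) (by omega),
      Nat.cast_zero, mul_zero]
  by_cases hmem : k₀ ∈ coverDims (finrank F V) b
  · rw [Finset.sum_eq_single_of_mem k₀ hmem hzero]
    have := mul_conjCount_le_of_invariant (hx k₀ (by omega)) A U hU
    have hcard : Nat.card {X : Submodule F V // finrank F X = k₀} =
        Nat.card {X : Submodule F V // finrank F X = finrank F U} := by
      rcases le_total (finrank F U) (finrank F V - finrank F U) with h | h
      · rw [hk₀, min_eq_left h]
      · rw [hk₀, min_eq_right h]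
        exact Submodule.card_finrank_eq_compl (by omega)
    rw [hcard]
    exact_mod_cast this
  · rw [Finset.sum_eq_zero fun k hk => hzero k hk (by rintro rfl; exact hmem hk)]
    positivity

variable (c : ℕ) [Fact c.Prime] [CharP F c] (b : ℕ) [NeZero b]

theorem weight_le_of_commute [Nontrivial V] (x : ℕ → End F V)
    (hx : ∀ k, 2 * k ≤ finrank F V → IsTestElement (x k) k)
    (hb : IsLeast {p : ℕ | p.Prime ∧ p ∣ finrank F V} b)
    (A : NonUnitalSubring (End F V)) (p : ℕ) [NeZero p] (hp : p.Prime) (hpn : p ∣ finrank F V)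
    (φ : FiniteField.Extension F c p →ₐ[F] End F V) (hφ : ∀ a ∈ A, ∀ r, Commute (φ r) a) :
    (Nat.card (FiniteField.Extension F c b →ₐ[F] End F V) / b : ℚ) * conjCount (x 0) A +
      ∑ k ∈ coverDims (finrank F V) b,
      (Nat.card {X : Submodule F V // finrank F X = k} : ℚ) * conjCount (x k) A ≤
      Nat.card (V ≃ₗ[F] V) := by
  have hfr : finrank F (FiniteField.Extension F c p) = p := FiniteField.finrank_extension ..
  have hbpos : (0 : ℚ) < b := by exact_mod_cast hb.1.1.pos
  have h0 := conjCount_mul_card_le (hx 0 (by simp)) A φ hφ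
  rw [if_pos rfl, pow_one, hfr] at h0
  -- For p = b only x_0 contributes, since b ∤ k rules out the others, and the weight of x_0 was
  -- chosen to make the bound exactly 1.
  by_cases hpb : p = b
  · subst hpb
    rw [Finset.sum_eq_zero, add_zero, div_mul_eq_mul_div, div_le_iff₀ hbpos]
    · rw [mul_comm]
      exact_mod_cast h0
    · intro k hk
      have hk' := mem_coverDims.1 hk
      rw [conjCount_eq_zero_of_commute (hx k (by omega)) A φ hφ (by rw [hfr]; exact hk'.2),
        Nat.cast_zero, mul_zero]
  have hlt : b < p := lt_of_le_of_ne (hb.2 ⟨hp, hpn⟩) (Ne.symm hpb)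
  have hb2 := hb.1.1.two_le
  have hfrb : finrank F (FiniteField.Extension F c b) = b := FiniteField.finrank_extension ..
  have hq : 2 ≤ Nat.card F := Finite.one_lt_card
  -- Distinct primes b < p dividing n force n ≥ 2p, as the numerical estimates need.
  have hcop : b * p ∣ finrank F V :=
    ((Nat.coprime_primes hb.1.1 hp).2 (Ne.symm hpb)).mul_dvd_of_dvd_of_dvd hb.1.2 hpn
  have hn2p : 2 * p ≤ finrank F V :=
    (Nat.mul_le_mul_right p hb2).trans (Nat.le_of_dvd finrank_pos hcop)
  have hΦp := AlgHomModule.card_end_mul (F := F) (V := V) (K := FiniteField.Extension F c p)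
    (by rwa [hfr])
  have hΦb := AlgHomModule.card_end_mul (F := F) (V := V) (K := FiniteField.Extension F c b)
    (by rw [hfrb]; exact hb.1.2)
  rw [hfr] at hΦp
  rw [hfrb] at hΦb
  have := AlgHomModule.finite_end (F := F) (V := V) (K := FiniteField.Extension F c p)
  set Np := Nat.card (FiniteField.Extension F c p →ₐ[F] End F V)
  set Nb := Nat.card (FiniteField.Extension F c b →ₐ[F] End F V)
  set G := Nat.card (V ≃ₗ[F] V)
  have hNp : 0 < Np := Nat.card_pos_iff.2 ⟨⟨φ⟩, this⟩
  have hratio : 16 * p * Nb ≤ 7 * b * Np := by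
    have h1 := sixteen_mul_prod_le (Nat.card F) (finrank F V) b p hq hb2 hlt hb.1.2 hpn hn2p
    have hPb : 0 < ∏ i ∈ Finset.range (finrank F V / b),
        (Nat.card F ^ finrank F V - Nat.card F ^ (b * i)) := by
      refine Finset.prod_pos fun i hi => Nat.sub_pos_of_lt (Nat.pow_lt_pow_right hq ?_)
      rw [Finset.mem_range] at hi
      exact (Nat.mul_lt_mul_of_pos_left hi (by omega)).trans_le (Nat.mul_div_le _ _)
    refine Nat.le_of_mul_le_mul_right ?_ hPb
    calc _ = 16 * p * (Nb * ∏ i ∈ Finset.range (finrank F V / b),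
        (Nat.card F ^ finrank F V - Nat.card F ^ (b * i))) := by ring
      _ = (16 * p * ∏ i ∈ Finset.range (finrank F V / p),
        (Nat.card F ^ finrank F V - Nat.card F ^ (p * i))) * Np := by
          rw [hΦb, ← hΦp]; ring
      _ ≤ _ := Nat.mul_le_mul_right Np h1
      _ = _ := by ring
  have hsum : 16 * p ^ 2 * ∑ k ∈ coverDims (finrank F V) b,
      Nat.card {X : Submodule F V // finrank F X = k} ≤ 9 * Np :=
    (Nat.mul_le_mul_left _ (Submodule.sum_card_finrank_eq_le (finrank F V / 2) _
      fun k hk => (mem_coverDims.1 hk).1.2)).trans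
      (sixteen_mul_sq_mul_pow_le (Nat.card F) (finrank F V) p Np hq (by omega) hpn hn2p hΦp)
  have hk : ∀ k ∈ coverDims (finrank F V) b, conjCount (x k) A * Np ≤ G * p ^ 2 := by
    intro k hk
    have hk' := mem_coverDims.1 hk
    have := conjCount_mul_card_le (hx k (by omega)) A φ hφ
    rwa [if_neg (by omega), hfr] at this
  have hNpQ : (0 : ℚ) < Np := by exact_mod_cast hNp
  refine le_of_mul_le_mul_right ?_ hNpQ
  have h0Q : (conjCount (x 0) A * Np : ℚ) ≤ G * p := by exact_mod_cast h0
  have hratioQ : (16 * p * Nb : ℚ) ≤ 7 * b * Np := by exact_mod_cast hratio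
  have hsumQ : (16 * p ^ 2 * ∑ k ∈ coverDims (finrank F V) b,
      (Nat.card {X : Submodule F V // finrank F X = k} : ℚ)) ≤ 9 * Np := by exact_mod_cast hsum
  have hGQ : (0 : ℚ) ≤ G := by positivity
  -- The share of x_0 is at most 7/16 and that of all the other test elements together at most 9/16.
  have e1 : (Nb / b : ℚ) * conjCount (x 0) A * Np ≤ G * (7 / 16 * Np) := by
    calc (Nb / b : ℚ) * conjCount (x 0) A * Np
        = Nb / b * (conjCount (x 0) A * Np) := by ring
      _ ≤ Nb / b * (G * p) := mul_le_mul_of_nonneg_left h0Q (by positivity)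
      _ = G * (p * Nb / b) := by ring
      _ ≤ _ := by
        refine mul_le_mul_of_nonneg_left ?_ hGQ
        rw [div_le_iff₀ hbpos]
        linarith
  have e2 : (∑ k ∈ coverDims (finrank F V) b,
      (Nat.card {X : Submodule F V // finrank F X = k} : ℚ) * conjCount (x k) A) * Np ≤
      G * (9 / 16 * Np) := by
    calc _ ≤ ∑ k ∈ coverDims (finrank F V) b,
          (Nat.card {X : Submodule F V // finrank F X = k} : ℚ) * (G * p ^ 2) := by
          rw [Finset.sum_mul]
          refine Finset.sum_le_sum fun k hk' => ?_
          rw [mul_assoc]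
          refine mul_le_mul_of_nonneg_left ?_ (by positivity)
          exact_mod_cast hk k hk'
      _ = G * (p ^ 2 * ∑ k ∈ coverDims (finrank F V) b,
          (Nat.card {X : Submodule F V // finrank F X = k} : ℚ)) := by
          rw [← Finset.sum_mul]; ring
      _ ≤ _ := mul_le_mul_of_nonneg_left (by linarith) hGQ
  rw [add_mul]
  linarith

theorem weight_le_of_ne_top [Nontrivial V] (x : ℕ → End F V)
    (hx : ∀ k, 2 * k ≤ finrank F V → IsTestElement (x k) k)
    (hb : IsLeast {p : ℕ | p.Prime ∧ p ∣ finrank F V} b)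
    (A : NonUnitalSubring (End F V)) (hA : A ≠ ⊤) :
    (Nat.card (FiniteField.Extension F c b →ₐ[F] End F V) / b : ℚ) * conjCount (x 0) A +
      ∑ k ∈ coverDims (finrank F V) b,
      (Nat.card {X : Submodule F V // finrank F X = k} : ℚ) * conjCount (x k) A ≤
      Nat.card (V ≃ₗ[F] V) := by
  by_cases hs : ∀ r : F, algebraMap F (End F V) r ∈ A
  · let S : Subalgebra F (End F V) :=
      { A with
        one_mem' := by simpa using hs 1
        algebraMap_mem' := hs }
    have hS : S ≠ ⊤ := by
      intro h
      refine hA (eq_top_iff.2 fun a _ => ?_)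
      have : a ∈ S := h ▸ trivial
      exact this
    rcases S.exists_invariant_or_commuting c hS with ⟨U, hUb, hUt, hU⟩ | ⟨p, hp0, hp, hpn, φ, hφ⟩
    · exact weight_le_of_invariant b x hx A U hU hUb hUt _
    · exact weight_le_of_commute c b x hx hb A p hp hpn φ hφ
  · have hzero : ∀ k, 2 * k ≤ finrank F V → conjCount (x k) A = 0 := by
      intro k hk
      have : IsEmpty {g : V ≃ₗ[F] V // g.conjAlgEquiv F (x k) ∈ A} :=
        ⟨fun ⟨g, hg⟩ => hs fun r => (hx k hk).algebraMap_mem_of_conj A g hg r⟩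
      simp [conjCount]
    rw [hzero 0 (by simp), Finset.sum_eq_zero fun k hk => by
      have := mem_coverDims.1 hk
      rw [hzero k (by omega), Nat.cast_zero, mul_zero]]
    simp

theorem card_le_sum_conjCount (x : End F V) (C : Finset (NonUnitalSubring (End F V)))
    (hC : ∀ y, ∃ A ∈ C, y ∈ A) : Nat.card (V ≃ₗ[F] V) ≤ ∑ A ∈ C, conjCount x A := by
  have hfin := LinearEquiv.finite_aut (F := F) (V := V)
  choose f hf hmem using hC
  rw [← Finset.sum_coe_sort]
  simp only [conjCount]
  rw [← Nat.card_sigma]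
  refine Nat.card_le_card_of_injective
    (fun g => ⟨⟨f (g.conjAlgEquiv F x), hf _⟩, g, hmem _⟩) fun g h hgh => ?_
  exact congrArg (fun s : Σ A : C, {g : V ≃ₗ[F] V // g.conjAlgEquiv F x ∈ A.1} => s.2.1) hgh

theorem le_card_of_isProperSubringCover [Nontrivial V]
    (hb : IsLeast {p : ℕ | p.Prime ∧ p ∣ finrank F V} b)
    (C : Finset (NonUnitalSubring (End F V))) (hC : IsProperSubringCover C) :
    (Nat.card (FiniteField.Extension F c b →ₐ[F] End F V) / b : ℚ) +
      ∑ k ∈ coverDims (finrank F V) b,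
      (Nat.card {X : Submodule F V // finrank F X = k} : ℚ) ≤ C.card := by
  have hx : ∀ k, ∃ x : End F V, 2 * k ≤ finrank F V → IsTestElement x k := by
    intro k
    by_cases hk : 2 * k ≤ finrank F V
    · obtain ⟨x, hx⟩ := exists_isTestElement (V := V) c k finrank_pos hk
      exact ⟨x, fun _ => hx⟩
    · exact ⟨0, fun h => absurd h hk⟩
  choose x hx using hx
  have hfin := LinearEquiv.finite_aut (F := F) (V := V)
  have hG : (0 : ℚ) < Nat.card (V ≃ₗ[F] V) := by exact_mod_cast Nat.card_pos
  have hcov : ∀ k, (Nat.card (V ≃ₗ[F] V) : ℚ) ≤ ∑ A ∈ C, (conjCount (x k) A : ℚ) := by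
    intro k
    exact_mod_cast card_le_sum_conjCount (x k) C hC.2
  -- Sum the weight bound over the cover and exchange the sums; then each x_k is counted at least
  -- |GL(V)| times.
  have hw := Finset.sum_le_sum fun A hA => weight_le_of_ne_top c b x hx hb A (hC.1 A hA)
  rw [Finset.sum_const, nsmul_eq_mul, Finset.sum_add_distrib, ← Finset.mul_sum,
    Finset.sum_comm] at hw
  simp only [← Finset.mul_sum] at hw
  refine le_of_mul_le_mul_right (le_trans ?_ hw) hG
  rw [add_mul, Finset.sum_mul]
  refine add_le_add (mul_le_mul_of_nonneg_left (hcov 0) (by positivity))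
    (Finset.sum_le_sum fun k _ => mul_le_mul_of_nonneg_left (hcov k) (by positivity))

end

/-! ### The upper bound: invariant subspaces and centralizers -/

section

variable {F V : Type*} [Field F] [Finite F] [AddCommGroup V] [Module F V] [FiniteDimensional F V]

omit [Finite F] in
-- Let M = (a) and let d be its residue degree. Each nonzero v in ker a generates a copy of A/M. If
-- d ≤ n/2, the hypothesis applies to it. If not, two such copies always meet, so ker a is a single
-- copy; the image of a has dimension n - d < n/2, divisible by b, and b ∣ n gives b ∣ d.
theorem dvd_finrank_quotient_of_forall_invariant {A : Type*} [CommRing A] [IsPrincipalIdealRing A]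
    [Algebra F A] [FiniteDimensional F A] (ρ : A →ₐ[F] End F V) (hρ : Function.Injective ρ)
    (b : ℕ) (hbn : b ∣ finrank F V)
    (h : ∀ U : Submodule F V, (∀ a, ∀ u ∈ U, ρ a u ∈ U) → 2 * finrank F U ≤ finrank F V →
      b ∣ finrank F U)
    (M : Ideal A) [M.IsMaximal] : b ∣ finrank F (A ⧸ M) := by
  have : IsArtinianRing A := IsArtinianRing.of_finite F A
  obtain ⟨a, ha⟩ := (IsPrincipalIdealRing.principal M).principal
  have hMa : ∀ r, r ∈ M ↔ ∃ s, s * a = r := fun r => by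
    rw [ha]; exact Submodule.mem_span_singleton
  have hcomm : ∀ r s v, ρ r (ρ s v) = ρ s (ρ r v) := fun r s v => by
    rw [← End.mul_apply, ← End.mul_apply, ← map_mul, ← map_mul, mul_comm]
  let orb : V → A →ₗ[F] V := fun v => (LinearMap.applyₗ v).comp ρ.toLinearMap
  have horb : ∀ v r, orb v r = ρ r v := fun _ _ => rfl
  have hmem : ∀ v, v ∈ LinearMap.range (orb v) := fun v => ⟨1, by simp [horb]⟩
  have horbinv : ∀ v r, ∀ u ∈ LinearMap.range (orb v), ρ r u ∈ LinearMap.range (orb v) := by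
    rintro v r _ ⟨s, rfl⟩
    exact ⟨r * s, by simp [horb]⟩
  have horble : ∀ v, ∀ u ∈ LinearMap.range (orb v),
      LinearMap.range (orb u) ≤ LinearMap.range (orb v) := by
    rintro v u hu _ ⟨s, rfl⟩
    exact horbinv v s u hu
  have hdim : ∀ v ∈ LinearMap.ker (ρ a), v ≠ 0 →
      finrank F (LinearMap.range (orb v)) = finrank F (A ⧸ M) := by
    intro v hv hv0
    rw [LinearMap.mem_ker] at hv
    let I : Ideal A :=
      { LinearMap.ker (orb v) with
        smul_mem' := fun r s hs => by
          change ρ (r * s) v = 0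
          have hs' : ρ s v = 0 := hs
          simp [hs'] }
    have hI : M = I := by
      refine Ideal.IsMaximal.eq_of_le ‹_› (fun h1 => hv0 ?_) fun r hr => ?_
      · have : (1 : A) ∈ I := h1 ▸ trivial
        have : ρ 1 v = 0 := this
        simpa using this
      · obtain ⟨s, rfl⟩ := (hMa r).1 hr
        change ρ (s * a) v = 0
        simp [hv]
    have h1 := LinearMap.finrank_range_add_finrank_ker (orb v)
    have h2 := Submodule.finrank_quotient_add_finrank (M.restrictScalars F)
    have h3 : LinearMap.ker (orb v) = M.restrictScalars F := by rw [hI]; rfl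
    have h4 : finrank F (A ⧸ M) = finrank F (A ⧸ M.restrictScalars F) := rfl
    rw [h3] at h1
    omega
  -- By faithfulness, an injective a would be a non-zero-divisor, hence a unit of the Artinian ring,
  -- contradicting maximality.
  have hker : LinearMap.ker (ρ a) ≠ ⊥ := by
    intro hk
    have hu : IsUnit a := by
      refine IsArtinianRing.isUnit_of_mem_nonZeroDivisors ?_
      rw [mem_nonZeroDivisors_iff_right]
      intro s hs
      refine hρ ?_
      rw [map_zero]
      ext v
      refine LinearMap.ker_eq_bot.1 hk ?_
      rw [hcomm, ← End.mul_apply, ← map_mul, hs]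
      simp
    exact Ideal.IsMaximal.ne_top ‹_› (Ideal.eq_top_of_isUnit_mem M ((hMa a).2 ⟨1, one_mul a⟩) hu)
  obtain ⟨v, hv, hv0⟩ := Submodule.exists_mem_ne_zero_of_ne_bot hker
  by_cases hd : 2 * finrank F (A ⧸ M) ≤ finrank F V
  · rw [← hdim v hv hv0] at hd ⊢
    exact h _ (horbinv v) hd
  have hkeq : LinearMap.range (orb v) = LinearMap.ker (ρ a) := by
    refine le_antisymm ?_ fun w hw => ?_
    · rintro _ ⟨s, rfl⟩
      rw [LinearMap.mem_ker] at hv ⊢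
      rw [horb, hcomm, hv, map_zero]
    · by_cases hw0 : w = 0
      · exact hw0 ▸ Submodule.zero_mem _
      have hne : LinearMap.range (orb v) ⊓ LinearMap.range (orb w) ≠ ⊥ := by
        intro hbot
        have h1 := Submodule.finrank_sup_add_finrank_inf_eq
          (LinearMap.range (orb v)) (LinearMap.range (orb w))
        have h2 := Submodule.finrank_le
          (LinearMap.range (orb v) ⊔ LinearMap.range (orb w))
        rw [hbot, finrank_bot, hdim v hv hv0, hdim w hw hw0] at h1
        omega
      obtain ⟨u, ⟨huv, huw⟩, hu0⟩ := Submodule.exists_mem_ne_zero_of_ne_bot hne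
      have hu : u ∈ LinearMap.ker (ρ a) := by
        obtain ⟨s, rfl⟩ := huv
        rw [LinearMap.mem_ker] at hv ⊢
        rw [horb, hcomm, hv, map_zero]
      have e1 := Submodule.eq_of_le_of_finrank_eq (horble v u huv)
        ((hdim u hu hu0).trans (hdim v hv hv0).symm)
      have e2 := Submodule.eq_of_le_of_finrank_eq (horble w u huw)
        ((hdim u hu hu0).trans (hdim w hw hw0).symm)
      rw [← e1, e2]
      exact hmem w
  have h1 := LinearMap.finrank_range_add_finrank_ker (ρ a)
  rw [← hkeq, hdim v hv hv0] at h1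
  have h2 := h (LinearMap.range (ρ a)) (by
    rintro r _ ⟨u, rfl⟩
    exact ⟨ρ r u, hcomm _ _ _⟩) (by omega)
  exact (Nat.dvd_add_right h2).1 (h1 ▸ hbn)

/-- `K` embeds in each residue field, hence in their product, the reduced quotient of `A`.
Separability makes `K` formally étale, so this map lifts through the nilradical. -/
theorem nonempty_algHom_of_forall_dvd_finrank_quotient (K A : Type*) [Field K] [Algebra F K]
    [FiniteDimensional F K] [CommRing A] [Algebra F A] [FiniteDimensional F A]
    (h : ∀ M : Ideal A, M.IsMaximal → finrank F K ∣ finrank F (A ⧸ M)) :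
    Nonempty (K →ₐ[F] A) := by
  have : IsArtinianRing A := IsArtinianRing.of_finite F A
  have : Finite A := Module.finite_of_finite F
  have : Finite K := Module.finite_of_finite F
  have hM : ∀ M : MaximalSpectrum A, Nonempty (K →ₐ[F] A ⧸ M.asIdeal) := by
    intro M
    let _ : Field (A ⧸ M.asIdeal) := Ideal.Quotient.field M.asIdeal
    have : Finite (A ⧸ M.asIdeal) := Finite.of_surjective _ Ideal.Quotient.mk_surjective
    exact FiniteField.nonempty_algHom_of_finrank_dvd (h _ M.isMaximal)
  have : Algebra.FormallyEtale F K := Algebra.FormallyEtale.of_isSeparable F K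
  let e : (A ⧸ nilradical A) ≃ₐ[F] ∀ M : MaximalSpectrum A, A ⧸ M.asIdeal :=
    (IsArtinianRing.quotNilradicalEquivPi A).restrictScalars F
  let f : K →ₐ[F] A ⧸ nilradical A :=
    (e.symm : _ →ₐ[F] A ⧸ nilradical A).comp (AlgHom.pi fun M => (hM M).some)
  exact ⟨Algebra.FormallySmooth.lift (nilradical A) (IsArtinianRing.isNilpotent_nilradical) f⟩

theorem exists_invariant_or_commute (K : Type*) [Field K] [Algebra F K] [FiniteDimensional F K]
    (hK : finrank F K ∣ finrank F V) (x : End F V) :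
    (∃ U : Submodule F V, ¬ finrank F K ∣ finrank F U ∧ 2 * finrank F U ≤ finrank F V ∧
      ∀ u ∈ U, x u ∈ U) ∨ ∃ φ : K →ₐ[F] End F V, ∀ a, Commute (φ a) x := by
  by_contra! hcon
  obtain ⟨h1, h2⟩ := hcon
  let A := AdjoinRoot (minpoly F x)
  have hmonic := minpoly.monic (Algebra.IsIntegral.isIntegral (R := F) x)
  have : FiniteDimensional F A := hmonic.finite_adjoinRoot
  have : IsPrincipalIdealRing A :=
    IsPrincipalIdealRing.of_surjective (AdjoinRoot.mk (minpoly F x)) AdjoinRoot.mk_surjective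
  let ρ : A →ₐ[F] End F V :=
    Ideal.Quotient.liftₐ (Ideal.span {minpoly F x}) (Polynomial.aeval x) (by
      intro p hp
      rw [Ideal.mem_span_singleton] at hp
      exact Polynomial.aeval_eq_zero_of_dvd_aeval_eq_zero hp (minpoly.aeval F x))
  have hρmk : ∀ p, ρ (AdjoinRoot.mk (minpoly F x) p) = Polynomial.aeval x p := fun _ => rfl
  have hρ : Function.Injective ρ := by
    rw [injective_iff_map_eq_zero]
    intro r hr
    obtain ⟨p, rfl⟩ := AdjoinRoot.mk_surjective r
    rw [hρmk] at hr
    exact AdjoinRoot.mk_eq_zero.2 (minpoly.dvd F x hr)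
  have hx : ρ (AdjoinRoot.root (minpoly F x)) = x := by
    rw [← AdjoinRoot.mk_X, hρmk, Polynomial.aeval_X]
  obtain ⟨f⟩ := nonempty_algHom_of_forall_dvd_finrank_quotient (F := F) K A fun M hM =>
    dvd_finrank_quotient_of_forall_invariant ρ hρ _ hK (fun U hU hle => by
      by_contra hnd
      obtain ⟨u, hu, hxu⟩ := h1 U hnd hle
      exact hxu (by simpa only [hx] using hU (AdjoinRoot.root (minpoly F x)) u hu)) M
  obtain ⟨a, ha⟩ := h2 (ρ.comp f)
  refine ha ?_
  have hcomm := (Commute.all (f a) (AdjoinRoot.root (minpoly F x))).map ρ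
  rwa [hx] at hcomm

/-- The subring of endomorphisms leaving `U` invariant. -/
def Submodule.stabilizerSubring {F V : Type*} [Field F] [AddCommGroup V] [Module F V]
    (U : Submodule F V) : NonUnitalSubring (End F V) where
  carrier := {a | ∀ u ∈ U, a u ∈ U}
  zero_mem' _ _ := by simp
  add_mem' ha hb u hu := U.add_mem (ha u hu) (hb u hu)
  neg_mem' ha u hu := U.neg_mem (ha u hu)
  mul_mem' ha hb u hu := ha _ (hb u hu)

/-- The subring of endomorphisms commuting with the image of `φ`. -/
def AlgHomModule.centralizer {F V K : Type*} [Field F] [AddCommGroup V] [Module F V]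
    [Field K] [Algebra F K] (φ : K →ₐ[F] End F V) : NonUnitalSubring (End F V) :=
  NonUnitalSubring.centralizer (Set.range φ)

omit [Finite F] [FiniteDimensional F V] in
theorem AlgHomModule.mem_centralizer {K : Type*} [Field K] [Algebra F K]
    {φ : K →ₐ[F] End F V} {x : End F V} :
    x ∈ AlgHomModule.centralizer φ ↔ ∀ a, Commute (φ a) x := by
  rw [AlgHomModule.centralizer, NonUnitalSubring.mem_centralizer_iff]
  simp [Commute, SemiconjBy]

omit [Finite F] [FiniteDimensional F V] in
theorem Submodule.stabilizerSubring_ne_top {U : Submodule F V} (hb : U ≠ ⊥) (ht : U ≠ ⊤) :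
    U.stabilizerSubring ≠ ⊤ := by
  intro h
  obtain ⟨u, hu, hu0⟩ := Submodule.exists_mem_ne_zero_of_ne_bot hb
  obtain ⟨w, hw⟩ := SetLike.exists_not_mem_of_ne_top U ht rfl
  obtain ⟨f, hf⟩ : ∃ f : Dual F V, f u ≠ 0 := by
    by_contra! hf
    exact hu0 ((forall_dual_apply_eq_zero_iff F u).1 hf)
  have hmem : f.smulRight w ∈ U.stabilizerSubring := h ▸ trivial
  -- The rank-one map v ↦ f(v)w sends u ∈ U to a nonzero multiple of w ∉ U.
  exact hw ((U.smul_mem_iff hf).1 (hmem u hu))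

omit [Finite F] [FiniteDimensional F V] in
theorem AlgHomModule.centralizer_ne_top [Nontrivial V] {K : Type*} [Field K] [Algebra F K]
    (hK : 1 < finrank F K) (φ : K →ₐ[F] End F V) : AlgHomModule.centralizer φ ≠ ⊤ := by
  intro h
  obtain ⟨v, hv⟩ := exists_ne (0 : V)
  obtain ⟨f, hf⟩ : ∃ f : Dual F V, f v ≠ 0 := by
    by_contra! hf
    exact hv ((forall_dual_apply_eq_zero_iff F v).1 hf)
  have hmem : f.smulRight v ∈ AlgHomModule.centralizer φ := h ▸ trivial
  rw [AlgHomModule.mem_centralizer] at hmem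
  -- Commuting with a rank-one map of image Fv forces φ(K)v ⊆ Fv, which would embed `K` in a line.
  have hspan : ∀ a, φ a v ∈ Submodule.span F {v} := by
    intro a
    have h1 : φ a (f v • v) = f (φ a v) • v := congrArg (fun g : End F V => g v) (hmem a)
    rw [map_smul] at h1
    exact ((Submodule.span F {v}).smul_mem_iff hf).1
      (h1 ▸ Submodule.smul_mem _ _ (Submodule.mem_span_singleton_self v))
  let j : K →ₗ[F] Submodule.span F {v} :=
    ((LinearMap.applyₗ v).comp φ.toLinearMap).codRestrict _ hspan
  have hj : Function.Injective j := by
    rw [injective_iff_map_eq_zero]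
    intro a ha
    by_contra ha0
    have h1 : φ a v = 0 := congrArg Subtype.val ha
    have h2 : φ (a⁻¹ * a) v = 0 := by rw [map_mul, End.mul_apply, h1, map_zero]
    rw [inv_mul_cancel₀ ha0, map_one] at h2
    exact hv h2
  have := LinearMap.finrank_le_finrank_of_injective hj
  rw [finrank_span_singleton hv] at this
  omega

/-- Precomposing φ with the Galois automorphisms of `K` gives [K : F] distinct embeddings with the
same image, hence the same centralizer. -/
theorem AlgHomModule.mul_ncard_range_centralizer_le [Nontrivial V] (K : Type*) [Field K]
    [Algebra F K] [FiniteDimensional F K] :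
    finrank F K * (Set.range (AlgHomModule.centralizer (F := F) (V := V) (K := K))).ncard ≤
      Nat.card (K →ₐ[F] End F V) := by
  classical
  have := AlgHomModule.finite_end (F := F) (V := V) (K := K)
  have : Finite K := Module.finite_of_finite F
  let _ := Fintype.ofFinite (K →ₐ[F] End F V)
  rw [← Set.image_univ, ← Finset.coe_univ, ← Finset.coe_image, Set.ncard_coe_finset,
    Nat.card_eq_fintype_card, ← Finset.card_univ,
    Finset.card_eq_sum_card_image (AlgHomModule.centralizer (F := F) (V := V) (K := K)),
    mul_comm, ← smul_eq_mul]
  refine Finset.card_nsmul_le_sum _ _ _ fun y hy => ?_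
  obtain ⟨φ, -, rfl⟩ := Finset.mem_image.1 hy
  rw [← IsGalois.card_aut_eq_finrank F K]
  rw [← Fintype.card_coe, ← Nat.card_eq_fintype_card]
  refine Nat.card_le_card_of_injective
    (fun σ : K ≃ₐ[F] K => ⟨φ.comp (σ : K →ₐ[F] K), ?_⟩) fun σ τ h => ?_
  · simp only [Finset.mem_filter, Finset.mem_univ, true_and]
    ext x
    rw [AlgHomModule.mem_centralizer, AlgHomModule.mem_centralizer]
    exact ⟨fun h a => by simpa using h (σ.symm a), fun h a => h (σ a)⟩
  · ext a
    have h1 : φ (σ a) = φ (τ a) := DFunLike.congr_fun (congrArg Subtype.val h) a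
    exact φ.toRingHom.injective h1

end

/-! ### The explicit cover, the closed formula and the theorem -/

theorem IsProperSubringCover.exists_of_ringEquiv {R S : Type*} [NonUnitalRing R] [NonUnitalRing S]
    (e : R ≃+* S) (C : Finset (NonUnitalSubring R)) (hC : IsProperSubringCover C) :
    ∃ D : Finset (NonUnitalSubring S), IsProperSubringCover D ∧ D.card = C.card := by
  classical
  have hinj : Function.Injective fun A : NonUnitalSubring R => A.comap (e.symm : S →ₙ+* R) := by
    intro A B hAB
    ext x
    have := SetLike.ext_iff.1 hAB (e x)
    simpa using this
  refine ⟨C.image (fun A => A.comap (e.symm : S →ₙ+* R)), ⟨?_, fun y => ?_⟩,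
    Finset.card_image_of_injective _ hinj⟩
  · intro B hB
    obtain ⟨A, hA, rfl⟩ := Finset.mem_image.1 hB
    refine fun h => hC.1 A hA (eq_top_iff.2 fun x _ => ?_)
    have : e x ∈ A.comap (e.symm : S →ₙ+* R) := h ▸ trivial
    simpa using this
  · obtain ⟨A, hA, hy⟩ := hC.2 (e.symm y)
    exact ⟨_, Finset.mem_image_of_mem _ hA, by simpa using hy⟩

section

variable {F V : Type*} [Field F] [Finite F] [AddCommGroup V] [Module F V] [FiniteDimensional F V]

theorem sum_coverDims_card_eq_ncard (b : ℕ) :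
    ∑ k ∈ coverDims (finrank F V) b, Nat.card {X : Submodule F V // finrank F X = k} =
      Set.ncard {U : Submodule F V | ¬ b ∣ finrank F U ∧ 2 * finrank F U ≤ finrank F V} := by
  have := Submodule.finite_of_finite_field (F := F) (V := V)
  rw [← Finset.sum_coe_sort, ← Nat.card_sigma, ← Nat.card_coe_set_eq]
  refine Nat.card_congr
    { toFun := fun X => ⟨X.2.1, by
        have := mem_coverDims.1 X.1.2
        rw [Set.mem_ofPred_eq, X.2.2]
        exact ⟨this.2, by omega⟩⟩
      invFun := fun U => ⟨⟨finrank F U.1, mem_coverDims.2 ⟨⟨Nat.pos_of_ne_zero fun h =>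
        U.2.1 (h ▸ dvd_zero b), by have := U.2.2; omega⟩, U.2.1⟩⟩, U.1, rfl⟩
      left_inv := ?_
      right_inv := fun _ => rfl }
  rintro ⟨⟨k, hk⟩, X, hX⟩
  simp only at hX
  subst hX
  rfl

theorem exists_isProperSubringCover_card_le [Nontrivial V] (K : Type*) [Field K] [Algebra F K]
    [FiniteDimensional F K] (h1 : 1 < finrank F K) (hK : finrank F K ∣ finrank F V) :
    ∃ C : Finset (NonUnitalSubring (End F V)), IsProperSubringCover C ∧
      (C.card : ℚ) ≤ (Nat.card (K →ₐ[F] End F V) / finrank F K : ℚ) +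
        ∑ k ∈ coverDims (finrank F V) (finrank F K),
          (Nat.card {X : Submodule F V // finrank F X = k} : ℚ) := by
  have := Submodule.finite_of_finite_field (F := F) (V := V)
  have := AlgHomModule.finite_end (F := F) (V := V) (K := K)
  let T : Set (Submodule F V) :=
    {U | ¬ finrank F K ∣ finrank F U ∧ 2 * finrank F U ≤ finrank F V}
  let S₁ : Set (NonUnitalSubring (End F V)) := Submodule.stabilizerSubring '' T
  let S₂ : Set (NonUnitalSubring (End F V)) :=
    Set.range (AlgHomModule.centralizer (F := F) (V := V) (K := K))
  have hfin : (S₁ ∪ S₂).Finite := (T.toFinite.image _).union (Set.finite_range _)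
  refine ⟨hfin.toFinset, ⟨?_, ?_⟩, ?_⟩
  · intro A hA
    rw [Set.Finite.mem_toFinset] at hA
    rcases hA with ⟨U, hU, rfl⟩ | ⟨φ, rfl⟩
    · refine Submodule.stabilizerSubring_ne_top ?_ ?_
      · rintro rfl
        exact hU.1 (by simp)
      · rintro rfl
        exact hU.1 (by simpa using hK)
    · exact AlgHomModule.centralizer_ne_top h1 φ
  · intro x
    rcases exists_invariant_or_commute K hK x with ⟨U, h2, h3, hU⟩ | ⟨φ, hφ⟩
    · exact ⟨_, hfin.mem_toFinset.2 (Or.inl ⟨U, ⟨h2, h3⟩, rfl⟩), hU⟩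
    · exact ⟨_, hfin.mem_toFinset.2 (Or.inr ⟨φ, rfl⟩), AlgHomModule.mem_centralizer.2 hφ⟩
  · rw [← Set.ncard_eq_toFinset_card _ hfin]
    have e1 : (S₁ ∪ S₂).ncard ≤ T.ncard + S₂.ncard :=
      (Set.ncard_union_le _ _).trans (Nat.add_le_add_right (Set.ncard_image_le T.toFinite) _)
    have e2 := AlgHomModule.mul_ncard_range_centralizer_le (F := F) (V := V) K
    have e3 := sum_coverDims_card_eq_ncard (F := F) (V := V) (finrank F K)
    have e4 : (S₂.ncard : ℚ) ≤ Nat.card (K →ₐ[F] End F V) / finrank F K := by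
      rw [le_div_iff₀ (by exact_mod_cast (by omega : 0 < finrank F K)), mul_comm]
      exact_mod_cast e2
    have e5 : ((S₁ ∪ S₂).ncard : ℚ) ≤ T.ncard + S₂.ncard := by exact_mod_cast e1
    have e6 : (∑ k ∈ coverDims (finrank F V) (finrank F K),
        (Nat.card {X : Submodule F V // finrank F X = k} : ℚ)) = T.ncard := by exact_mod_cast e3
    linarith

/-- With d = [K : F], the factors of |GL_n(q)| with d ∣ i are exactly those of |GL_{n/d}(q^d)| and
cancel. -/
theorem AlgHomModule.card_end_eq_prod (K : Type*) [Field K] [Algebra F K] [FiniteDimensional F K]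
    (h : finrank F K ∣ finrank F V) :
    (Nat.card (K →ₐ[F] End F V) : ℚ) =
      ∏ i ∈ (Finset.Icc 1 (finrank F V - 1)).filter (fun i => ¬ finrank F K ∣ i),
        ((Nat.card F : ℚ) ^ finrank F V - (Nat.card F : ℚ) ^ i) := by
  have hq : 1 < Nat.card F := Finite.one_lt_card
  have hd : 0 < finrank F K := finrank_pos
  have key := AlgHomModule.card_end_mul (F := F) (V := V) (K := K) h
  set n := finrank F V
  set d := finrank F K
  set q := Nat.card F
  have hpos : ∀ i ∈ Finset.range (n / d), d * i < n := fun i hi =>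
    (Nat.mul_lt_mul_of_pos_left (Finset.mem_range.1 hi) hd).trans_le (Nat.mul_div_le _ _)
  have h1 : (Finset.range n).filter (fun i => d ∣ i) = (Finset.range (n / d)).image (d * ·) := by
    ext i
    simp only [Finset.mem_filter, Finset.mem_range, Finset.mem_image]
    constructor
    · rintro ⟨hi, j, rfl⟩
      refine ⟨j, ?_, rfl⟩
      rw [Nat.lt_div_iff_mul_lt_of_dvd hd.ne' h]
      rwa [mul_comm]
    · rintro ⟨j, hj, rfl⟩
      exact ⟨hpos j (Finset.mem_range.2 hj), dvd_mul_right _ _⟩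
  have h2 : (Finset.range n).filter (fun i => ¬ d ∣ i) =
      (Finset.Icc 1 (n - 1)).filter (fun i => ¬ d ∣ i) := by
    ext i
    simp only [Finset.mem_filter, Finset.mem_range, Finset.mem_Icc]
    refine and_congr_left fun hi => ?_
    have : i ≠ 0 := by rintro rfl; exact hi (dvd_zero _)
    omega
  rw [← Finset.prod_filter_mul_prod_filter_not (Finset.range n) (fun i => d ∣ i), h1, h2,
    Finset.prod_image fun i _ j _ hij => Nat.eq_of_mul_eq_mul_left hd hij, mul_comm] at key
  have hne : 0 < ∏ i ∈ Finset.range (n / d), (q ^ n - q ^ (d * i)) :=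
    Finset.prod_pos fun i hi => Nat.sub_pos_of_lt (Nat.pow_lt_pow_right hq (hpos i hi))
  rw [Nat.eq_of_mul_eq_mul_left hne key, Nat.cast_prod]
  refine Finset.prod_congr rfl fun i hi => ?_
  have hi' := Finset.mem_Icc.1 (Finset.mem_filter.1 hi).1
  rw [Nat.cast_sub (Nat.pow_le_pow_right (by omega) (by omega))]
  push_cast
  rfl

end

theorem theorem1p3 {F : Type*} [Field F] [Fintype F] (q : ℕ) (hq : Fintype.card F = q)
    (n : ℕ) (hn : 2 ≤ n) (b : ℕ) (hb : IsLeast {p : ℕ | p.Prime ∧ p ∣ n} b) :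
    IsProperlyCoverable (Matrix (Fin n) (Fin n) F) ∧
    (coveringNumber (Matrix (Fin n) (Fin n) F) : ℚ) =
      1 / (b : ℚ) * ∏ i ∈ (Finset.Icc 1 (n - 1)).filter (fun i => ¬ b ∣ i),
        ((q : ℚ) ^ n - (q : ℚ) ^ i) + (numSubspaces F n b : ℚ) := by
  obtain ⟨c, hc⟩ := CharP.exists F
  have : Fact c.Prime := ⟨CharP.char_is_prime F c⟩
  have : NeZero b := ⟨hb.1.1.ne_zero⟩
  have : NeZero n := ⟨by omega⟩
  have hV : finrank F (Fin n → F) = n := by simp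
  have hK : finrank F (FiniteField.Extension F c b) = b := FiniteField.finrank_extension ..
  have hdvd : finrank F (FiniteField.Extension F c b) ∣ finrank F (Fin n → F) := by
    rw [hK, hV]; exact hb.1.2
  have hsub : (∑ k ∈ coverDims n b,
      (Nat.card {X : Submodule F (Fin n → F) // finrank F X = k} : ℚ)) = numSubspaces F n b := by
    have h := sum_coverDims_card_eq_ncard (F := F) (V := Fin n → F) b
    rw [hV] at h
    have hset : {U : Submodule F (Fin n → F) | ¬ b ∣ finrank F U ∧ 2 * finrank F U ≤ n} =
        {U : Submodule F (Fin n → F) | ¬ b ∣ finrank F U ∧ (finrank F U : ℚ) ≤ (n : ℚ) / 2} := by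
      ext U
      simp only [Set.mem_ofPred_eq]
      refine and_congr_right fun _ => ?_
      rw [le_div_iff₀ two_pos, mul_comm]
      exact_mod_cast Iff.rfl
    rw [hset] at h
    exact_mod_cast h
  have hcard := AlgHomModule.card_end_eq_prod (F := F) (V := Fin n → F)
    (FiniteField.Extension F c b) hdvd
  rw [hK, hV, Nat.card_eq_fintype_card (α := F), hq] at hcard
  let e : Matrix (Fin n) (Fin n) F ≃+* End F (Fin n → F) :=
    (Matrix.toLinAlgEquiv' : Matrix (Fin n) (Fin n) F ≃ₐ[F] _).toRingEquiv
  obtain ⟨C, hC, hCle⟩ := exists_isProperSubringCover_card_le (F := F) (V := Fin n → F)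
    (FiniteField.Extension F c b) (by rw [hK]; exact hb.1.1.one_lt) hdvd
  obtain ⟨D, hD, hDC⟩ := hC.exists_of_ringEquiv e.symm
  have hmem : D.card ∈ {k : ℕ | ∃ C : Finset (NonUnitalSubring (Matrix (Fin n) (Fin n) F)),
    IsProperSubringCover C ∧ C.card = k} := ⟨D, hD, rfl⟩
  refine ⟨⟨D, hD⟩, le_antisymm ?_ ?_⟩
  · have h1 : coveringNumber (Matrix (Fin n) (Fin n) F) ≤ C.card := hDC ▸ Nat.sInf_le hmem
    rw [hK, hV, hsub, hcard] at hCle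
    rw [one_div_mul_eq_div]
    exact le_trans (by exact_mod_cast h1) hCle
  · obtain ⟨E, hE, hEcard⟩ := Nat.sInf_mem ⟨_, hmem⟩
    obtain ⟨E', hE', hE'E⟩ := hE.exists_of_ringEquiv e
    have h1 := le_card_of_isProperSubringCover (F := F) (V := Fin n → F) c b (by rwa [hV]) E' hE'
    rw [hV, hsub, hcard, hE'E, hEcard] at h1
    rw [one_div_mul_eq_div]
    exact h1
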